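/- Let $S$ be a countable set and let $(X_t)_{t\ge 0}$ be a time-homogeneous continuous-time Markov process on $S$ with right-continuous paths (for the discrete topology) and transition rates $a(j,k)\ge 0$, $\sum_k a(j,k)<\infty$ for every $j$; neither symmetry nor any structure of $S$ is assumed. Write $p_t(j,k)=\mathbb P[X_t=k\mid X_0=j]$. Fix $i\in S$, start the process in $i$, let $L_t=\int_0^t \mathbf 1_{\{X_s=i\}}\,ds$ be its local time in $i$, and put $$G_\infty=\int_0^\infty p_t(i,i)\,dt\in(0,\infty],\qquad H_\infty=\int_0^\infty t\,p_t(i,i)\,dt,\qquad \kappa_{cr}=\frac1{G_\infty}\quad(\tfrac1\infty:=0).$$ Then for every $\kappa>0$ the limit $r(\kappa)=\lim_{t\to\infty}\frac1t\log\mathbb E[e^{\kappa L_t}]$ exists in $\mathbb R$, and: (i) for every $\kappa>0$: $r(\kappa)\ge 0$, and $r(\kappa)>0$ if and only if $\kappa>\kappa_{cr}$; (iii) $r(\kappa)\le\kappa$ for every $\kappa>0$, and $r(\kappa)/\kappa\to1$ as $\kappa\to\infty$. If moreover $p_t(i,i)\sim c\,t^{-\alpha}$ as $t\to\infty$ for some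 constants $c>0$, $\alpha>0$ (where $h_1\sim h_2$ means $h_1/h_2\to1$), then also: (ii) $r$ is strictly convex on $(\kappa_{cr},\infty)$; (iv) if $\alpha\le1$, then $\kappa_{cr}=0$ and, as $\kappa\downarrow0$, $$r(\kappa)\sim\begin{cases}\kappa^{\frac1{1-\alpha}}\,(c\,\Gamma(1-\alpha))^{\frac1{1-\alpha}}, & 0<\alpha<1,\\ \exp\bigl(-(c\kappa)^{-1}+o(\kappa^{-1})\bigr), & \alpha=1;\end{cases}$$ (v) if $\alpha>1$, then $G_\infty<\infty$, $\kappa_{cr}>0$ and, as $\kappa\downarrow\kappa_{cr}$, $$r(\kappa)\sim\begin{cases}(\kappa-\kappa_{cr})^{\frac1{\alpha-1}}\left(\dfrac{G_\infty^2(\alpha-1)}{c\,\Gamma(2-\alpha)}\right)^{\frac1{\alpha-1}}, & 1<\alpha<2,\\[2mm] \dfrac{\kappa-\kappa_{cr}}{\log\bigl(1/(\kappa-\kappa_{cr})\bigr)}\,\dfrac{G_\infty^2}{c}, & \alpha=2,\\[2mm] (\kappa-\kappa_{cr})\,\dfrac{G_\infty^2}{H_\infty}\quad\text{with } H_\infty<\infty,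 & \alpha>2.\end{cases}$$ -/

import Mathlib

open MeasureTheory Filter Topology Asymptotics
open scoped NNReal ENNReal

namespace LocalTimeRate

noncomputable section

variable {S Ω : Type*} [MeasurableSpace Ω]

/-- The transition probability `p_t(j,k) = P^j[X_t = k]`, where `P j` is the law under which the
process `X` is started in `j`. -/
def transProb (P : S → Measure Ω) (X : ℝ≥0 → Ω → S) (t : ℝ≥0) (j k : S) : ℝ :=
  (P j).real {ω | X t ω = k}

/-- `X` is, under the family of laws `P`, a time-homogeneous continuous-time Markov process
(with right-continuous paths in the discrete space `S`) with transition rates `a`. The diagonal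
entries `a j j` are irrelevant. -/
structure IsMarkovProcess [MeasurableSpace S] (a : S → S → ℝ) (P : S → Measure Ω)
    (X : ℝ≥0 → Ω → S) : Prop where
  rate_nonneg : ∀ j k, 0 ≤ a j k
  rate_summable : ∀ j, Summable (a j)
  isProbabilityMeasure : ∀ j, IsProbabilityMeasure (P j)
  measurable : ∀ t, Measurable (X t)
  right_continuous : ∀ ω t, ∀ᶠ s in 𝓝[≥] t, X s ω = X t ω
  start : ∀ j, ∀ᵐ ω ∂(P j), X 0 ω = j
  /-- The Markov property with respect to the natural filtration. -/
  markov : ∀ (s t : ℝ≥0) (A : Set Ω),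
    MeasurableSet[⨆ u : Set.Iic s, MeasurableSpace.comap (X u) inferInstance] A →
    ∀ j k l, P j (A ∩ {ω | X s ω = k} ∩ {ω | X (s + t) ω = l}) =
      P j (A ∩ {ω | X s ω = k}) * P k {ω | X t ω = l}
  /-- The rate of jumping from `j` to `k` is `a j k`. -/
  rate_offDiag : ∀ j k, j ≠ k →
    Tendsto (fun t : ℝ≥0 => transProb P X t j k / t) (𝓝[>] 0) (𝓝 (a j k))
  /-- The total rate of leaving `j` is the sum of the rates `a j k`, `k ≠ j`. -/
  rate_diag : ∀ j,
    Tendsto (fun t : ℝ≥0 => (1 - transProb P X t j j) / t) (𝓝[>] 0)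
      (𝓝 (∑' k : {k : S // k ≠ j}, a j k))

/-- The local time `L_t = ∫_0^t δ_i(X_s) ds` in `i`. -/
def localTime (X : ℝ≥0 → Ω → S) (i : S) (t : ℝ≥0) (ω : Ω) : ℝ :=
  ∫ s in (0 : ℝ)..t, Set.indicator {i} (fun _ => (1 : ℝ)) (X s.toNNReal ω)

/-- `E[exp (κ L_t)]` for the local time in `i` of the process started in `i`. -/
def expMoment (P : S → Measure Ω) (X : ℝ≥0 → Ω → S) (i : S) (κ : ℝ) (t : ℝ≥0) : ℝ :=
  ∫ ω, Real.exp (κ * localTime X i t ω) ∂(P i)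

/-- `G_∞ = ∫_0^∞ p_t(i,i) dt ∈ [0,∞]`. -/
def green (P : S → Measure Ω) (X : ℝ≥0 → Ω → S) (i : S) : ℝ≥0∞ :=
  ∫⁻ t in Set.Ioi (0 : ℝ), ENNReal.ofReal (transProb P X t.toNNReal i i)

/-- `H_∞ = ∫_0^∞ t p_t(i,i) dt ∈ [0,∞]`. -/
def greenMoment (P : S → Measure Ω) (X : ℝ≥0 → Ω → S) (i : S) : ℝ≥0∞ :=
  ∫⁻ t in Set.Ioi (0 : ℝ), ENNReal.ofReal (t * transProb P X t.toNNReal i i)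

/-- `κ_cr = 1 / G_∞`, with `1 / ∞ = 0`. -/
def kappaCr (P : S → Measure Ω) (X : ℝ≥0 → Ω → S) (i : S) : ℝ :=
  ((green P X i)⁻¹).toReal

end

end LocalTimeRate

/-! Everything reduces to a scalar renewal equation for M(t) = E[exp(κ L_t)]. Differentiating exp(κ
L_t) in time and applying the Markov property at visits to i gives M = 1 + κ p * M with p(t) =
p_t(i,i) (`IsMarkovProcess.lintegral_renewal`, `IsMarkovProcess.isRenewalSolution`). Multiplying by
exp(-lt) turns κ p into a kernel of total mass κ p̂(l), where p̂ is the Laplace transform of p. The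
solution therefore grows at most like exp(lt) if this mass is below 1 and at least like it if the
mass is above 1 (`le_exp_mul`, `exists_exp_mul_le`). Hence r(κ) is the positive root of κ p̂(l) = 1,
or 0 if there is none.

Since p̂ decreases strictly from the mass G of p to 0, a root exists exactly when κ > 1/G. The
bounds on r and its behaviour at infinity come from p ≤ 1 and p(0+) = 1.

The critical asymptotics invert Abelian theorems. The tail c t^(-α) determines p̂(l) for α ≤ 1, or G
- p̂(l) for α > 1, as l ↓ 0. This is `tendsto_scaled_integral` for power behaviour and
`tendsto_log_integral` at the logarithmic borders α = 1, 2; for α > 2 plain dominated convergence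
suffices. One then substitutes l = r(κ) and p̂(r(κ)) = 1/κ.

For strict convexity, r is convex as a limit of convex functions (`IsMarkovProcess.convexOn_rate`).
If it were not strictly convex it would be affine on an interval, so p̂(l) = s/(l+b) on an interval,
and by analyticity on the whole half-line. That is the transform of s exp(-bt), which is
incompatible with a polynomial tail (`laplace_ne_rational`). -/

namespace LocalTimeRate

noncomputable section

/-! ### The Laplace transform of p and the root defining the rate -/

/-- The analytic properties of a return probability `t ↦ p_t(i,i)` that are used below. -/
structure IsReturnProfile (p : ℝ → ℝ) : Prop where
  measurable : Measurable p
  nonneg : ∀ t, 0 ≤ p t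
  le_one : ∀ t, p t ≤ 1
  tendsto_zero : Tendsto p (𝓝[>] 0) (𝓝 1)

/-- The Laplace transform of `p`. -/
def laplace (p : ℝ → ℝ) (l : ℝ) : ℝ := ∫ t in Set.Ioi (0 : ℝ), Real.exp (-(l * t)) * p t

/-- The total mass of `p` on the half-line. -/
def mass (p : ℝ → ℝ) : ℝ≥0∞ := ∫⁻ t in Set.Ioi (0 : ℝ), ENNReal.ofReal (p t)

open Classical in
/-- The exponential growth rate of the renewal equation with kernel `κ p`: the positive root `l` of
`κ * laplace p l = 1` if there is one, and zero otherwise. -/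
def rate (p : ℝ → ℝ) (κ : ℝ) : ℝ :=
  if h : ∃ l, 0 < l ∧ κ * laplace p l = 1 then h.choose else 0

lemma integrableOn_exp_neg_mul {l : ℝ} (hl : 0 < l) :
    IntegrableOn (fun t : ℝ => Real.exp (-(l * t))) (Set.Ioi 0) := by
  simpa [neg_mul] using exp_neg_integrableOn_Ioi 0 hl

lemma integral_exp_neg_mul {l : ℝ} (hl : 0 < l) :
    ∫ t in Set.Ioi (0 : ℝ), Real.exp (-(l * t)) = 1 / l := by
  have := integral_exp_mul_Ioi (a := -l) (by linarith) 0
  simpa [neg_mul, neg_div_neg_eq] using this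

namespace IsReturnProfile

variable {p : ℝ → ℝ} (hp : IsReturnProfile p)

include hp

lemma integrableOn_laplace {l : ℝ} (hl : 0 < l) :
    IntegrableOn (fun t => Real.exp (-(l * t)) * p t) (Set.Ioi 0) := by
  refine (integrableOn_exp_neg_mul hl).mono' ?_ ?_
  · exact ((by fun_prop : Measurable fun t : ℝ => Real.exp (-(l * t))).mul
      hp.measurable).aestronglyMeasurable
  · refine ae_of_all _ fun t => ?_
    rw [norm_mul, Real.norm_eq_abs, Real.norm_eq_abs, abs_of_pos (Real.exp_pos _),
      abs_of_nonneg (hp.nonneg t)]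
    exact mul_le_of_le_one_right (Real.exp_pos _).le (hp.le_one t)

lemma laplace_le {l : ℝ} (hl : 0 < l) : laplace p l ≤ 1 / l := by
  rw [← integral_exp_neg_mul hl]
  refine setIntegral_mono (hp.integrableOn_laplace hl) (integrableOn_exp_neg_mul hl) fun t => ?_
  exact mul_le_of_le_one_right (Real.exp_pos _).le (hp.le_one t)

lemma exists_pos_lower {ε : ℝ} (hε : 0 < ε) : ∃ δ > 0, ∀ t ∈ Set.Ioo 0 δ, 1 - ε < p t := by
  have h := hp.tendsto_zero.eventually (lt_mem_nhds (show 1 - ε < 1 by linarith))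
  obtain ⟨δ, hδ, h⟩ := mem_nhdsGT_iff_exists_Ioo_subset.1 h
  exact ⟨δ, hδ, fun t ht => h ht⟩

/-- An integral over the half-line against `p` of a positive function is positive. -/
lemma setIntegral_mul_pos {f : ℝ → ℝ} (hf : ∀ t ∈ Set.Ioi (0 : ℝ), 0 < f t)
    (hi : IntegrableOn (fun t => f t * p t) (Set.Ioi 0)) :
    0 < ∫ t in Set.Ioi (0 : ℝ), f t * p t := by
  obtain ⟨δ, hδ, h⟩ := hp.exists_pos_lower (ε := 1) one_pos
  rw [setIntegral_pos_iff_support_of_nonneg_ae _ hi]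
  · refine lt_of_lt_of_le ?_ (measure_mono (μ := volume) (s := Set.Ioo 0 δ) ?_)
    · simpa using hδ
    · intro t ht
      refine ⟨?_, ht.1⟩
      have := h t ht
      exact (mul_pos (hf t ht.1) (by linarith)).ne'
  · filter_upwards [ae_restrict_mem measurableSet_Ioi] with t ht
    exact mul_nonneg (hf t ht).le (hp.nonneg t)

lemma laplace_pos {l : ℝ} (hl : 0 < l) : 0 < laplace p l :=
  hp.setIntegral_mul_pos (fun _ _ => Real.exp_pos _) (hp.integrableOn_laplace hl)

lemma laplace_strictAntiOn : StrictAntiOn (laplace p) (Set.Ioi 0) := by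
  intro l hl m hm hlm
  have hi := (hp.integrableOn_laplace hl).sub (hp.integrableOn_laplace hm)
  have h := hp.setIntegral_mul_pos (f := fun t => Real.exp (-(l * t)) - Real.exp (-(m * t)))
    (fun t ht => sub_pos.2 (Real.exp_lt_exp.2 (by
      have : 0 < (m - l) * t := mul_pos (sub_pos.2 hlm) ht
      linarith)))
    (hi.congr (ae_of_all _ fun t => by simp [sub_mul]))
  simp only [sub_mul] at h
  rw [integral_sub (hp.integrableOn_laplace hl) (hp.integrableOn_laplace hm)] at h
  exact sub_pos.1 h

/-- Integration against the measure with density `p` on the half-line. -/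
lemma integral_withDensity (f : ℝ → ℝ) :
    ∫ t, f t ∂((volume.restrict (Set.Ioi (0 : ℝ))).withDensity fun t => ENNReal.ofReal (p t)) =
      ∫ t in Set.Ioi (0 : ℝ), f t * p t := by
  rw [integral_withDensity_eq_integral_toReal_smul hp.measurable.ennreal_ofReal (by simp)]
  refine integral_congr_ae (ae_of_all _ fun t => ?_)
  simp [ENNReal.toReal_ofReal (hp.nonneg t), mul_comm]

lemma mem_interior_integrableExpSet {l : ℝ} (hl : 0 < l) :
    -l ∈ interior (ProbabilityTheory.integrableExpSet id
      ((volume.restrict (Set.Ioi (0 : ℝ))).withDensity fun t => ENNReal.ofReal (p t))) := by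
  refine mem_interior.2 ⟨Set.Iio 0, ?_, isOpen_Iio, by simpa using hl⟩
  intro s hs
  have hs' : 0 < -s := by simpa using hs
  change Integrable _ _
  rw [integrable_withDensity_iff_integrable_smul' hp.measurable.ennreal_ofReal (by simp)]
  refine (hp.integrableOn_laplace hs').congr (ae_of_all _ fun t => ?_)
  simp [ENNReal.toReal_ofReal (hp.nonneg t), mul_comm]

lemma laplace_eq_mgf (l : ℝ) :
    laplace p l = ProbabilityTheory.mgf id
      ((volume.restrict (Set.Ioi (0 : ℝ))).withDensity fun t => ENNReal.ofReal (p t)) (-l) := by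
  rw [ProbabilityTheory.mgf, hp.integral_withDensity]
  simp [laplace]

/-- Inherited from the moment generating function of the measure with density p, taken at -l.
Analyticity is what lets a local identity for the transform spread to the whole half-line in the
strict convexity argument. -/
lemma laplace_analyticOnNhd : AnalyticOnNhd ℝ (laplace p) (Set.Ioi 0) := by
  intro l hl
  have h := ProbabilityTheory.analyticAt_mgf (hp.mem_interior_integrableExpSet hl)
  rw [funext hp.laplace_eq_mgf]
  exact h.fun_comp (analyticAt_id.neg)

lemma laplace_continuousOn : ContinuousOn (laplace p) (Set.Ioi 0) :=
  hp.laplace_analyticOnNhd.continuousOn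

/-- Differentiation of the Laplace moments under the integral sign. -/
lemma hasDerivAt_laplace_moment {l : ℝ} (hl : 0 < l) (n : ℕ) :
    HasDerivAt (fun l => ∫ t in Set.Ioi (0 : ℝ), t ^ n * Real.exp (-(l * t)) * p t)
      (-∫ t in Set.Ioi (0 : ℝ), t ^ (n + 1) * Real.exp (-(l * t)) * p t) l := by
  have h := ProbabilityTheory.hasDerivAt_integral_pow_mul_exp_real
    (hp.mem_interior_integrableExpSet hl) n
  have h2 := h.scomp l (hasDerivAt_neg l)
  simp only [Function.comp_def, hp.integral_withDensity] at h2
  simpa using h2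

lemma ofReal_laplace {l : ℝ} (hl : 0 < l) :
    ENNReal.ofReal (laplace p l) =
      ∫⁻ t in Set.Ioi (0 : ℝ), ENNReal.ofReal (Real.exp (-(l * t)) * p t) := by
  refine ofReal_integral_eq_lintegral_ofReal (hp.integrableOn_laplace hl) (ae_of_all _ fun t => ?_)
  exact mul_nonneg (Real.exp_pos _).le (hp.nonneg t)

lemma integrableOn_of_mass (h : mass p ≠ ⊤) : IntegrableOn p (Set.Ioi 0) :=
  ⟨hp.measurable.aestronglyMeasurable, by
    rw [hasFiniteIntegral_iff_ofReal (ae_of_all _ hp.nonneg)]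
    exact h.lt_top⟩

lemma mass_toReal : (mass p).toReal = ∫ t in Set.Ioi (0 : ℝ), p t := by
  rw [integral_eq_lintegral_of_nonneg_ae (ae_of_all _ hp.nonneg)
    hp.measurable.aestronglyMeasurable]
  rfl

lemma integrableOn_one_sub_exp_mul (h : mass p ≠ ⊤) {l : ℝ} (hl : 0 < l) :
    IntegrableOn (fun t => (1 - Real.exp (-(l * t))) * p t) (Set.Ioi 0) :=
  ((hp.integrableOn_of_mass h).sub (hp.integrableOn_laplace hl)).congr
    (ae_of_all _ fun t => by simp [sub_mul])

lemma mass_sub_laplace (h : mass p ≠ ⊤) {l : ℝ} (hl : 0 < l) :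
    (mass p).toReal - laplace p l =
      ∫ t in Set.Ioi (0 : ℝ), (1 - Real.exp (-(l * t))) * p t := by
  rw [hp.mass_toReal, laplace, ← integral_sub (hp.integrableOn_of_mass h)
    (hp.integrableOn_laplace hl)]
  simp [sub_mul]

lemma laplace_lt_mass (h : mass p ≠ ⊤) {l : ℝ} (hl : 0 < l) : laplace p l < (mass p).toReal := by
  rw [← sub_pos, hp.mass_sub_laplace h hl]
  refine hp.setIntegral_mul_pos (fun t ht => ?_) (hp.integrableOn_one_sub_exp_mul h hl)
  have : 0 < l * t := mul_pos hl ht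
  simpa using this

lemma ofReal_laplace_lt_mass {l : ℝ} (hl : 0 < l) : ENNReal.ofReal (laplace p l) < mass p := by
  by_cases h : mass p = ⊤
  · simp [h]
  · rw [ENNReal.ofReal_lt_iff_lt_toReal (hp.laplace_pos hl).le h]
    exact hp.laplace_lt_mass h hl

lemma mass_pos : 0 < mass p := bot_le.trans_lt (hp.ofReal_laplace_lt_mass one_pos)

/-- Monotone convergence along l = 1/(n+1). Working in `ℝ≥0∞` treats finite and infinite mass at
once. -/
lemma tendsto_ofReal_laplace_seq :
    Tendsto (fun n : ℕ => ENNReal.ofReal (laplace p (1 / ((n : ℝ) + 1)))) atTop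
      (𝓝 (mass p)) := by
  have hpos : ∀ n : ℕ, 0 < 1 / ((n : ℝ) + 1) := fun n => by positivity
  simp only [fun n => hp.ofReal_laplace (hpos n)]
  refine lintegral_tendsto_of_tendsto_of_monotone (fun n => ?_) ?_ ?_
  · exact (((by fun_prop : Measurable fun t : ℝ => Real.exp (-(1 / ((n : ℝ) + 1) * t))).mul
      hp.measurable).ennreal_ofReal).aemeasurable
  · filter_upwards [ae_restrict_mem measurableSet_Ioi] with t ht m n hmn
    refine ENNReal.ofReal_le_ofReal (mul_le_mul_of_nonneg_right ?_ (hp.nonneg t))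
    refine Real.exp_le_exp.2 (neg_le_neg (mul_le_mul_of_nonneg_right ?_ (le_of_lt ht)))
    exact one_div_le_one_div_of_le (by positivity) (by exact_mod_cast Nat.succ_le_succ hmn)
  · refine ae_of_all _ fun t => ENNReal.tendsto_ofReal ?_
    have h1 : Tendsto (fun n : ℕ => Real.exp (-(1 / ((n : ℝ) + 1) * t)) * p t) atTop
        (𝓝 (Real.exp (-(0 * t)) * p t)) :=
      ((Real.continuous_exp.tendsto _).comp
        ((tendsto_one_div_add_atTop_nhds_zero_nat.mul_const t).neg)).mul_const _
    simpa using h1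

/-- The supercriticality criterion. -/
lemma exists_root_iff {κ : ℝ} (hκ : 0 < κ) :
    (∃ l, 0 < l ∧ κ * laplace p l = 1) ↔ ((mass p)⁻¹).toReal < κ := by
  have key : ((mass p)⁻¹).toReal < κ ↔ ENNReal.ofReal κ⁻¹ < mass p := by
    rw [← ENNReal.lt_ofReal_iff_toReal_lt (ENNReal.inv_ne_top.2 hp.mass_pos.ne'),
      ENNReal.inv_lt_iff_inv_lt, ENNReal.ofReal_inv_of_pos hκ]
  rw [key]
  constructor
  · rintro ⟨l, hl, h⟩
    rw [← eq_inv_of_mul_eq_one_right h]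
    exact hp.ofReal_laplace_lt_mass hl
  · intro h
    obtain ⟨n, hn⟩ := (hp.tendsto_ofReal_laplace_seq.eventually (lt_mem_nhds h)).exists
    have hn0 : 0 < 1 / ((n : ℝ) + 1) := by positivity
    rw [ENNReal.ofReal_lt_ofReal_iff (hp.laplace_pos hn0)] at hn
    -- Since p ≤ 1, the point l = κ always serves as right endpoint for the intermediate value
    -- theorem.
    have h2 : laplace p κ ≤ κ⁻¹ := by simpa using hp.laplace_le hκ
    have hle : 1 / ((n : ℝ) + 1) ≤ κ := by
      by_contra hcon
      have := hp.laplace_strictAntiOn hκ hn0 (not_le.1 hcon)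
      linarith
    obtain ⟨l, hl, hlk⟩ := intermediate_value_Icc' hle (hp.laplace_continuousOn.mono
      fun x hx => hn0.trans_le hx.1) ⟨h2, hn.le⟩
    exact ⟨l, hn0.trans_le hl.1, by rw [hlk, mul_inv_cancel₀ hκ.ne']⟩

/-- Strict monotonicity of the transform makes the root unique, so the choice in `rate` is
immaterial. -/
lemma rate_eq {κ l : ℝ} (hl : 0 < l) (h : κ * laplace p l = 1) : rate p κ = l := by
  have hex : ∃ l, 0 < l ∧ κ * laplace p l = 1 := ⟨l, hl, h⟩
  rw [rate, dif_pos hex]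
  have hc := hex.choose_spec
  have hκ : κ ≠ 0 := by rintro rfl; simp at h
  exact hp.laplace_strictAntiOn.injOn hc.1 hl (mul_left_cancel₀ hκ (hc.2.trans h.symm))

lemma rate_spec {κ : ℝ} (hκ : 0 < κ) (h : ((mass p)⁻¹).toReal < κ) :
    0 < rate p κ ∧ κ * laplace p (rate p κ) = 1 := by
  obtain ⟨l, hl, hlk⟩ := (hp.exists_root_iff hκ).2 h
  rw [hp.rate_eq hl hlk]
  exact ⟨hl, hlk⟩

lemma rate_eq_zero {κ : ℝ} (hκ : 0 < κ) (h : ¬ ((mass p)⁻¹).toReal < κ) : rate p κ = 0 := by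
  rw [← hp.exists_root_iff hκ] at h
  rw [rate, dif_neg h]

lemma rate_nonneg {κ : ℝ} (hκ : 0 < κ) : 0 ≤ rate p κ := by
  by_cases h : ((mass p)⁻¹).toReal < κ
  · exact (hp.rate_spec hκ h).1.le
  · exact (hp.rate_eq_zero hκ h).ge

lemma rate_pos_iff {κ : ℝ} (hκ : 0 < κ) : 0 < rate p κ ↔ ((mass p)⁻¹).toReal < κ := by
  refine ⟨fun h => ?_, fun h => (hp.rate_spec hκ h).1⟩
  by_contra hcon
  exact h.ne' (hp.rate_eq_zero hκ hcon)

/-- Above the rate the kernel `κ p` is subcritical. -/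
lemma mul_laplace_lt_one {κ l : ℝ} (hκ : 0 < κ) (hl : rate p κ < l) : κ * laplace p l < 1 := by
  have hl0 : 0 < l := (hp.rate_nonneg hκ).trans_lt hl
  by_cases h : ((mass p)⁻¹).toReal < κ
  · obtain ⟨h1, h2⟩ := hp.rate_spec hκ h
    rw [← h2]
    exact mul_lt_mul_of_pos_left (hp.laplace_strictAntiOn h1 hl0 hl) hκ
  · by_contra hcon
    apply h
    rw [← ENNReal.lt_ofReal_iff_toReal_lt (ENNReal.inv_ne_top.2 hp.mass_pos.ne'),
      ENNReal.inv_lt_iff_inv_lt, ← ENNReal.ofReal_inv_of_pos hκ]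
    refine lt_of_le_of_lt (ENNReal.ofReal_le_ofReal ?_) (hp.ofReal_laplace_lt_mass hl0)
    rw [inv_le_iff_one_le_mul₀ hκ, mul_comm]
    exact not_lt.1 hcon

/-- Below the rate the kernel `κ p` is supercritical. -/
lemma one_lt_mul_laplace {κ l : ℝ} (hκ : 0 < κ) (hl0 : 0 < l) (hl : l < rate p κ) :
    1 < κ * laplace p l := by
  obtain ⟨h1, h2⟩ := hp.rate_spec hκ ((hp.rate_pos_iff hκ).1 (hl0.trans hl))
  rw [← h2]
  exact mul_lt_mul_of_pos_left (hp.laplace_strictAntiOn hl0 h1 hl) hκ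

lemma rate_le {κ : ℝ} (hκ : 0 < κ) : rate p κ ≤ κ := by
  by_contra! hcon
  have h1 := hp.one_lt_mul_laplace hκ hκ hcon
  have h2 := mul_le_mul_of_nonneg_left (hp.laplace_le hκ) hκ.le
  rw [mul_one_div_cancel hκ.ne'] at h2
  linarith

lemma rate_lt_of_mul_laplace_lt {κ l : ℝ} (hκ : 0 < κ) (hl : 0 < l) (h : κ * laplace p l < 1) :
    rate p κ < l := by
  by_contra! hcon
  rcases hcon.lt_or_eq with h1 | h1
  · exact absurd h (hp.one_lt_mul_laplace hκ hl h1).le.not_gt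
  · have := (hp.rate_spec hκ ((hp.rate_pos_iff hκ).1 (hl.trans_le hcon))).2
    rw [← h1] at this
    linarith

lemma lt_rate_of_lt_mul_laplace {κ l : ℝ} (hκ : 0 < κ) (h : 1 < κ * laplace p l) (hl : 0 < l) :
    l < rate p κ := by
  by_contra! hcon
  rcases hcon.lt_or_eq with h1 | h1
  · exact absurd h (hp.mul_laplace_lt_one hκ h1).le.not_gt
  · have := (hp.rate_spec hκ ((hp.rate_pos_iff hκ).1 (h1 ▸ hl))).2
    rw [h1] at this
    linarith

lemma rate_strictMonoOn : StrictMonoOn (rate p) (Set.Ioi ((mass p)⁻¹).toReal) := by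
  intro x hx y hy hxy
  have hx0 : 0 < x := ENNReal.toReal_nonneg.trans_lt hx
  obtain ⟨h1, h2⟩ := hp.rate_spec hx0 hx
  refine hp.lt_rate_of_lt_mul_laplace (hx0.trans hxy) ?_ h1
  rw [← h2]
  exact mul_lt_mul_of_pos_right hxy (hp.laplace_pos h1)

/-- The density l exp(-lt) concentrates at 0, where p is close to 1. The lower bound keeps only an
interval (0, δ) on which p is nearly 1; the upper bound is p ≤ 1. -/
lemma tendsto_mul_laplace_atTop : Tendsto (fun l => l * laplace p l) atTop (𝓝 1) := by
  refine tendsto_order.2 ⟨fun b hb => ?_, fun b hb => ?_⟩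
  · obtain ⟨δ, hδ, h⟩ := hp.exists_pos_lower (ε := (1 - b) / 2) (by linarith)
    have hlim : Tendsto (fun l : ℝ => (1 - (1 - b) / 2) * (1 - Real.exp (-(l * δ)))) atTop
        (𝓝 ((1 - (1 - b) / 2) * (1 - 0))) := by
      refine Tendsto.const_mul _ (tendsto_const_nhds.sub ?_)
      exact Real.tendsto_exp_neg_atTop_nhds_zero.comp (tendsto_id.atTop_mul_const hδ)
    filter_upwards [hlim.eventually (lt_mem_nhds (show b < _ by linarith)), eventually_gt_atTop 0]
      with l hl hl0
    refine hl.trans_le ?_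
    have h1 : ∫ t in Set.Ioc 0 δ, (1 - (1 - b) / 2) * Real.exp (-(l * t)) ≤ laplace p l := by
      refine le_trans ?_ (setIntegral_mono_set (s := Set.Ioo 0 δ) (hp.integrableOn_laplace hl0)
        (ae_of_all _ fun t => mul_nonneg (Real.exp_pos _).le (hp.nonneg t))
        (Filter.Eventually.of_forall fun t ht => ht.1))
      rw [integral_Ioc_eq_integral_Ioo]
      refine setIntegral_mono_on ?_ ((hp.integrableOn_laplace hl0).mono_set fun t ht => ht.1)
        measurableSet_Ioo fun t ht => ?_
      · exact ((integrableOn_exp_neg_mul hl0).mono_set fun t ht => ht.1).const_mul _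
      · rw [mul_comm]
        exact mul_le_mul_of_nonneg_left (h t ht).le (Real.exp_pos _).le
    rw [← intervalIntegral.integral_of_le hδ.le, intervalIntegral.integral_const_mul] at h1
    have h2 : ∫ t in (0 : ℝ)..δ, Real.exp (-(l * t)) = (1 - Real.exp (-(l * δ))) / l := by
      rw [intervalIntegral.integral_eq_sub_of_hasDerivAt
        (f := fun t => -(Real.exp (-(l * t)) / l))]
      · simp; ring
      · intro t _
        have : HasDerivAt (fun t => -(Real.exp (-(l * t)) / l))
            (-(Real.exp (-(l * t)) * -(l * 1) / l)) t :=
          ((((hasDerivAt_id t).const_mul l).neg).exp.div_const l).neg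
        rwa [mul_one, mul_neg, neg_div, neg_neg, mul_div_cancel_right₀ _ hl0.ne'] at this
      · exact (by fun_prop : Continuous fun t : ℝ => Real.exp (-(l * t))).intervalIntegrable _ _
    rw [h2] at h1
    calc _ = l * ((1 - (1 - b) / 2) * ((1 - Real.exp (-(l * δ))) / l)) := by field_simp
      _ ≤ _ := mul_le_mul_of_nonneg_left h1 hl0.le
  · filter_upwards [eventually_gt_atTop 0] with l hl
    refine lt_of_le_of_lt ?_ hb
    have := mul_le_mul_of_nonneg_left (hp.laplace_le hl) hl.le
    rwa [mul_one_div_cancel hl.ne'] at this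

lemma tendsto_rate_atTop : Tendsto (rate p) atTop atTop := by
  refine tendsto_atTop.2 fun b => ?_
  have hb : 0 < max b 1 := by positivity
  have hL := hp.laplace_pos hb
  filter_upwards [eventually_gt_atTop (laplace p (max b 1))⁻¹] with κ hκ
  have hκ0 : 0 < κ := (inv_pos.2 hL).trans hκ
  refine (le_max_left b 1).trans (hp.lt_rate_of_lt_mul_laplace hκ0 ?_ hb).le
  rwa [← inv_lt_iff_one_lt_mul₀ hL]

/-- The root equation rewrites r/κ as r p̂(r), and r tends to infinity. -/
lemma tendsto_rate_div : Tendsto (fun κ => rate p κ / κ) atTop (𝓝 1) := by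
  refine (hp.tendsto_mul_laplace_atTop.comp hp.tendsto_rate_atTop).congr' ?_
  filter_upwards [eventually_gt_atTop 0, eventually_gt_atTop ((mass p)⁻¹).toReal] with κ h0 h1
  have := (hp.rate_spec h0 h1).2
  simp only [Function.comp]
  rw [eq_inv_of_mul_eq_one_right this, div_eq_mul_inv]

/-- The rate drops below b as soon as κ < 1/p̂(b), and this threshold exceeds the critical value.
The limit is taken within the positive reals so that asymptotics of p̂ at 0+ can be composed with
the rate. -/
lemma tendsto_rate_critical :
    Tendsto (rate p) (𝓝[>] ((mass p)⁻¹).toReal) (𝓝[>] 0) := by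
  have hcr : 0 ≤ ((mass p)⁻¹).toReal := ENNReal.toReal_nonneg
  refine tendsto_nhdsWithin_iff.2 ⟨tendsto_order.2 ⟨fun b hb => ?_, fun b hb => ?_⟩, ?_⟩
  · filter_upwards [self_mem_nhdsWithin] with κ hκ
    exact hb.trans_le (hp.rate_nonneg (hcr.trans_lt hκ))
  · have hL := hp.laplace_pos hb
    have h1 : ((mass p)⁻¹).toReal < (laplace p b)⁻¹ :=
      (hp.exists_root_iff (inv_pos.2 hL)).1 ⟨b, hb, inv_mul_cancel₀ hL.ne'⟩
    filter_upwards [Ioo_mem_nhdsGT h1] with κ hκ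
    refine hp.rate_lt_of_mul_laplace_lt (hcr.trans_lt hκ.1) hb ?_
    rw [← lt_div_iff₀ hL, one_div]
    exact hκ.2
  · filter_upwards [self_mem_nhdsWithin] with κ hκ
    exact (hp.rate_spec (hcr.trans_lt hκ) hκ).1

end IsReturnProfile

/-! ### Growth of solutions of the renewal equation -/

/-- `M` solves the renewal equation `M = 1 + κ p * M` on the half-line, with a priori bounds. -/
structure IsRenewalSolution (p : ℝ → ℝ) (κ : ℝ) (M : ℝ → ℝ) : Prop where
  measurable : Measurable M
  one_le : ∀ t, 0 ≤ t → 1 ≤ M t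
  le_exp : ∀ t, 0 ≤ t → M t ≤ Real.exp (κ * t)
  renewal : ∀ t, 0 ≤ t → M t = 1 + κ * ∫ s in Set.Ioc 0 t, p s * M (t - s)

namespace IsRenewalSolution

variable {p M : ℝ → ℝ} {κ : ℝ} (hM : IsRenewalSolution p κ M) (hp : IsReturnProfile p)

include hM hp

omit hp in
-- Exponential tilting is multiplicative along the convolution, so the tilted function solves a
-- renewal equation with the tilted kernel.
lemma exp_neg_mul_renewal (l : ℝ) {t : ℝ} (ht : 0 ≤ t) :
    Real.exp (-(l * t)) * M t = Real.exp (-(l * t)) + κ * ∫ s in Set.Ioc 0 t,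
      (Real.exp (-(l * s)) * p s) * (Real.exp (-(l * (t - s))) * M (t - s)) := by
  conv_lhs => rw [hM.renewal t ht]
  rw [mul_add, mul_one, mul_left_comm, ← integral_const_mul]
  congr 2
  refine integral_congr_ae (ae_of_all _ fun s => ?_)
  have : Real.exp (-(l * t)) = Real.exp (-(l * s)) * Real.exp (-(l * (t - s))) := by
    rw [← Real.exp_add]; ring_nf
  simp only [this]
  ring

lemma integrableOn_kernel (hκ : 0 < κ) {l : ℝ} (hl : 0 < l) (t : ℝ) :
    IntegrableOn (fun s => (Real.exp (-(l * s)) * p s) *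
      (Real.exp (-(l * (t - s))) * M (t - s))) (Set.Ioc 0 t) := by
  have hm := hM.measurable
  have hpm := hp.measurable
  refine Measure.integrableOn_of_bounded (M := Real.exp (κ * t)) (by simp)
    (by fun_prop : Measurable _).aestronglyMeasurable ?_
  filter_upwards [ae_restrict_mem measurableSet_Ioc] with s hs
  have h0 : 0 ≤ t - s := sub_nonneg.2 hs.2
  have h1 := hM.one_le _ h0
  rw [Real.norm_eq_abs, abs_of_nonneg (mul_nonneg (mul_nonneg (Real.exp_pos _).le (hp.nonneg s))
    (mul_nonneg (Real.exp_pos _).le (zero_le_one.trans h1)))]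
  have e1 : Real.exp (-(l * s)) ≤ 1 := by
    rw [Real.exp_le_one_iff]; nlinarith [mul_pos hl hs.1]
  have e2 : Real.exp (-(l * (t - s))) ≤ 1 := by
    rw [Real.exp_le_one_iff]; nlinarith [mul_nonneg hl.le h0]
  calc _ ≤ (1 * 1) * (1 * Real.exp (κ * (t - s))) := by
        refine mul_le_mul (mul_le_mul e1 (hp.le_one s) (hp.nonneg s) zero_le_one)
          (mul_le_mul e2 (hM.le_exp _ h0) (zero_le_one.trans h1) zero_le_one)
          (mul_nonneg (Real.exp_pos _).le (zero_le_one.trans h1)) (by norm_num)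
    _ ≤ _ := by
        rw [one_mul, one_mul, one_mul]
        exact Real.exp_le_exp.2 (mul_le_mul_of_nonneg_left (by linarith [hs.1]) hκ.le)

/-- The supremum A of the tilted solution over [0, t] satisfies A ≤ 1 + θA with θ = κ p̂(l) < 1. The
a priori bound `le_exp` makes A finite, so this can be solved for A with a constant independent of
t. -/
lemma le_exp_mul (hκ : 0 < κ) {l : ℝ} (hl : 0 < l) (h : κ * laplace p l < 1) {t : ℝ}
    (ht : 0 ≤ t) : M t ≤ (1 - κ * laplace p l)⁻¹ * Real.exp (l * t) := by
  set m : ℝ → ℝ := fun t => Real.exp (-(l * t)) * M t with hm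
  have hbdd : BddAbove (m '' Set.Icc 0 t) := by
    refine ⟨Real.exp (κ * t), ?_⟩
    rintro _ ⟨s, hs, rfl⟩
    have h1 := hM.one_le s hs.1
    calc m s ≤ 1 * Real.exp (κ * s) := by
          refine mul_le_mul ?_ (hM.le_exp s hs.1) (by linarith) zero_le_one
          rw [Real.exp_le_one_iff]; nlinarith [mul_nonneg hl.le hs.1]
      _ ≤ _ := by
          rw [one_mul]
          exact Real.exp_le_exp.2 (mul_le_mul_of_nonneg_left hs.2 hκ.le)
  have hne : (m '' Set.Icc 0 t).Nonempty := ⟨m 0, 0, ⟨le_rfl, ht⟩, rfl⟩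
  set A := sSup (m '' Set.Icc 0 t) with hA
  have hA0 : 0 ≤ A := by
    refine le_trans ?_ (le_csSup hbdd ⟨0, ⟨le_rfl, ht⟩, rfl⟩)
    exact mul_nonneg (Real.exp_pos _).le (zero_le_one.trans (hM.one_le 0 le_rfl))
  have hAle : A ≤ 1 + κ * laplace p l * A := by
    refine csSup_le hne ?_
    rintro _ ⟨s, hs, rfl⟩
    rw [hm]
    simp only
    rw [hM.exp_neg_mul_renewal l hs.1]
    refine add_le_add ?_ ?_
    · rw [Real.exp_le_one_iff]; nlinarith [mul_nonneg hl.le hs.1]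
    · rw [mul_assoc]
      refine mul_le_mul_of_nonneg_left ?_ hκ.le
      calc _ ≤ ∫ v in Set.Ioc 0 s, (Real.exp (-(l * v)) * p v) * A := by
            refine setIntegral_mono_on (hM.integrableOn_kernel hp hκ hl s)
              (((hp.integrableOn_laplace hl).mono_set fun v hv => hv.1).mul_const A)
              measurableSet_Ioc fun v hv => ?_
            refine mul_le_mul_of_nonneg_left ?_ (mul_nonneg (Real.exp_pos _).le (hp.nonneg v))
            exact le_csSup hbdd ⟨s - v, ⟨sub_nonneg.2 hv.2, by linarith [hv.1, hs.2]⟩, rfl⟩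
        _ ≤ _ := by
            rw [integral_mul_const]
            refine mul_le_mul_of_nonneg_right ?_ hA0
            exact setIntegral_mono_set (hp.integrableOn_laplace hl)
              (ae_of_all _ fun v => mul_nonneg (Real.exp_pos _).le (hp.nonneg v))
              (Filter.Eventually.of_forall fun v hv => hv.1)
  have hmt : m t ≤ A := le_csSup hbdd ⟨t, ⟨ht, le_rfl⟩, rfl⟩
  have hAC : A ≤ (1 - κ * laplace p l)⁻¹ := by
    rw [← one_div, le_div_iff₀ (by linarith)]
    linarith
  have hexp : M t = m t * Real.exp (l * t) := by
    rw [hm]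
    simp only
    rw [mul_right_comm, ← Real.exp_add]
    simp
  rw [hexp]
  exact mul_le_mul_of_nonneg_right (hmt.trans hAC) (Real.exp_pos _).le

/-- Cut the kernel at T while keeping its tilted mass θ above 1. The infimum A of the tilted
solution over [0, t] is then at least min(exp(-lT), θA), and A > 0 rules out the second alternative.
-/
lemma exists_exp_mul_le (hκ : 0 < κ) {l : ℝ} (hl : 0 < l) (h : 1 < κ * laplace p l) :
    ∃ c > 0, ∀ t, 0 ≤ t → c * Real.exp (l * t) ≤ M t := by
  obtain ⟨T, hT0, hT⟩ : ∃ T > 0, 1 < κ * ∫ s in Set.Ioc 0 T, Real.exp (-(l * s)) * p s := by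
    have h1 := (intervalIntegral_tendsto_integral_Ioi 0 (hp.integrableOn_laplace hl)
      tendsto_id).const_mul κ
    obtain ⟨T, hT, hT0⟩ := ((h1.eventually (lt_mem_nhds h)).and (eventually_gt_atTop 0)).exists
    refine ⟨T, hT0, ?_⟩
    rwa [id, intervalIntegral.integral_of_le hT0.le] at hT
  refine ⟨Real.exp (-(l * T)), Real.exp_pos _, fun t ht => ?_⟩
  set m : ℝ → ℝ := fun t => Real.exp (-(l * t)) * M t with hm
  have hlow : ∀ s ∈ Set.Icc 0 t, Real.exp (-(l * t)) ≤ m s := by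
    intro s hs
    rw [← mul_one (Real.exp (-(l * t)))]
    refine mul_le_mul ?_ (hM.one_le s hs.1) zero_le_one (Real.exp_pos _).le
    exact Real.exp_le_exp.2 (neg_le_neg (mul_le_mul_of_nonneg_left hs.2 hl.le))
  have hbdd : BddBelow (m '' Set.Icc 0 t) := by
    refine ⟨Real.exp (-(l * t)), ?_⟩
    rintro _ ⟨s, hs, rfl⟩
    exact hlow s hs
  have hne : (m '' Set.Icc 0 t).Nonempty := ⟨m 0, 0, ⟨le_rfl, ht⟩, rfl⟩
  set A := sInf (m '' Set.Icc 0 t) with hA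
  have hA0 : 0 < A := by
    refine (Real.exp_pos (-(l * t))).trans_le (le_csInf hne ?_)
    rintro _ ⟨s, hs, rfl⟩
    exact hlow s hs
  have hAle : min (Real.exp (-(l * T)))
      ((κ * ∫ s in Set.Ioc 0 T, Real.exp (-(l * s)) * p s) * A) ≤ A := by
    refine le_csInf hne ?_
    rintro _ ⟨s, hs, rfl⟩
    rcases le_or_gt s T with hsT | hsT
    · refine (min_le_left _ _).trans ?_
      rw [← mul_one (Real.exp (-(l * T)))]
      refine mul_le_mul ?_ (hM.one_le s hs.1) zero_le_one (Real.exp_pos _).le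
      exact Real.exp_le_exp.2 (neg_le_neg (mul_le_mul_of_nonneg_left hsT hl.le))
    · refine (min_le_right _ _).trans ?_
      rw [hm]
      simp only
      rw [hM.exp_neg_mul_renewal l hs.1, mul_assoc]
      refine le_add_of_nonneg_of_le (Real.exp_pos _).le (mul_le_mul_of_nonneg_left ?_ hκ.le)
      have hnn : ∀ v ∈ Set.Ioc 0 s, A ≤ Real.exp (-(l * (s - v))) * M (s - v) := fun v hv =>
        csInf_le hbdd ⟨s - v, ⟨sub_nonneg.2 hv.2, by linarith [hv.1, hs.2]⟩, rfl⟩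
      calc _ = ∫ v in Set.Ioc 0 T, (Real.exp (-(l * v)) * p v) * A := by
            rw [integral_mul_const]
        _ ≤ ∫ v in Set.Ioc 0 s, (Real.exp (-(l * v)) * p v) * A := by
            refine setIntegral_mono_set
              (((hp.integrableOn_laplace hl).mono_set fun v hv => hv.1).mul_const A)
              (ae_of_all _ fun v => mul_nonneg (mul_nonneg (Real.exp_pos _).le (hp.nonneg v))
                hA0.le) (Filter.Eventually.of_forall fun v hv => ⟨hv.1, hv.2.trans hsT.le⟩)
        _ ≤ _ := by
            refine setIntegral_mono_on
              (((hp.integrableOn_laplace hl).mono_set fun v hv => hv.1).mul_const A)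
              (hM.integrableOn_kernel hp hκ hl s) measurableSet_Ioc fun v hv => ?_
            exact mul_le_mul_of_nonneg_left (hnn v hv)
              (mul_nonneg (Real.exp_pos _).le (hp.nonneg v))
  have hAT : Real.exp (-(l * T)) ≤ A := by
    rcases min_le_iff.1 hAle with h1 | h1
    · exact h1
    -- Here θA ≤ A with θ > 1 and A > 0, a contradiction.
    · nlinarith
  have hmt : A ≤ m t := csInf_le hbdd ⟨t, ⟨ht, le_rfl⟩, rfl⟩
  have hexp : M t = m t * Real.exp (l * t) := by
    rw [hm]
    simp only
    rw [mul_right_comm, ← Real.exp_add]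
    simp
  rw [hexp]
  exact mul_le_mul_of_nonneg_right (hAT.trans hmt) (Real.exp_pos _).le

/-- The exponential growth rate of the solution of the renewal equation. -/
lemma tendsto_log_div (hκ : 0 < κ) :
    Tendsto (fun t : ℝ => (1 / t) * Real.log (M t)) atTop (𝓝 (rate p κ)) := by
  have hlim : ∀ c l : ℝ, Tendsto (fun t : ℝ => c / t + l) atTop (𝓝 l) := fun c l => by
    simpa using (tendsto_const_nhds.div_atTop tendsto_id).add_const l
  refine tendsto_order.2 ⟨fun b hb => ?_, fun b hb => ?_⟩
  · rcases lt_or_ge b 0 with hb0 | hb0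
    · filter_upwards [eventually_gt_atTop 0] with t ht
      exact hb0.trans_le (mul_nonneg (by positivity) (Real.log_nonneg (hM.one_le t ht.le)))
    · obtain ⟨l, hbl, hl⟩ := exists_between hb
      have hl0 : 0 < l := hb0.trans_lt hbl
      obtain ⟨c, hc, h⟩ := hM.exists_exp_mul_le hp hκ hl0 (hp.one_lt_mul_laplace hκ hl0 hl)
      filter_upwards [eventually_gt_atTop 0,
        (hlim (Real.log c) l).eventually (lt_mem_nhds hbl)] with t ht hbt
      refine hbt.trans_le ?_
      have h1 := Real.log_le_log (by positivity) (h t ht.le)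
      rw [Real.log_mul hc.ne' (Real.exp_pos _).ne', Real.log_exp] at h1
      calc _ = (1 / t) * (Real.log c + l * t) := by field_simp
        _ ≤ _ := mul_le_mul_of_nonneg_left h1 (by positivity)
  · obtain ⟨l, hl, hlb⟩ := exists_between hb
    have hl0 : 0 < l := (hp.rate_nonneg hκ).trans_lt hl
    have hlt := hp.mul_laplace_lt_one hκ hl
    set c := (1 - κ * laplace p l)⁻¹ with hc
    have hc0 : 0 < c := inv_pos.2 (by linarith)
    filter_upwards [eventually_gt_atTop 0,
      (hlim (Real.log c) l).eventually (gt_mem_nhds hlb)] with t ht hbt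
    refine lt_of_le_of_lt ?_ hbt
    have h1 := Real.log_le_log (zero_lt_one.trans_le (hM.one_le t ht.le))
      (hM.le_exp_mul hp hκ hl0 hlt ht.le)
    rw [Real.log_mul hc0.ne' (Real.exp_pos _).ne', Real.log_exp] at h1
    calc _ ≤ (1 / t) * (Real.log c + l * t) := mul_le_mul_of_nonneg_left h1 (by positivity)
      _ = _ := by field_simp

end IsRenewalSolution

/-! ### Measurability and pathwise calculus of the local time -/

/-- The indicator that the path is in `i` at the real time `s`. -/
def occupation {S Ω : Type*} (X : ℝ≥0 → Ω → S) (i : S) (s : ℝ) (ω : Ω) : ℝ :=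
  Set.indicator {i} (fun _ => (1 : ℝ)) (X s.toNNReal ω)

section Occupation

variable {S Ω : Type*} {X : ℝ≥0 → Ω → S} {i : S}

lemma occupation_nonneg (s : ℝ) (ω : Ω) : 0 ≤ occupation X i s ω :=
  Set.indicator_nonneg (fun _ _ => zero_le_one) _

lemma occupation_le_one (s : ℝ) (ω : Ω) : occupation X i s ω ≤ 1 :=
  Set.indicator_le_self' (fun _ _ => zero_le_one) _

lemma localTime_eq (t : ℝ≥0) (ω : Ω) :
    localTime X i t ω = ∫ s in (0 : ℝ)..t, occupation X i s ω := rfl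

lemma localTime_nonneg (t : ℝ≥0) (ω : Ω) : 0 ≤ localTime X i t ω :=
  intervalIntegral.integral_nonneg t.2 fun s _ => occupation_nonneg s ω

lemma ofReal_occupation (s : ℝ) (ω : Ω) :
    ENNReal.ofReal (occupation X i s ω) =
      {ω | X s.toNNReal ω = i}.indicator (fun _ => 1) ω := by
  by_cases h : X s.toNNReal ω = i <;> simp [occupation, h]

/-- The grid point `(k + 1) / (n + 1)`, truncated at `T`. -/
def gridUpper (T : ℝ≥0) (n k : ℕ) : ℝ≥0 := min T (((k : ℝ≥0) + 1) / ((n : ℝ≥0) + 1))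

/-- Times are rounded up because paths are continuous only from the right. Truncation at T keeps the
approximating times in the past of T, which is what yields adaptedness. -/
lemma tendsto_gridUpper {T s : ℝ≥0} (hs : s ≤ T) :
    Tendsto (fun n : ℕ => gridUpper T n ⌊((n : ℝ≥0) + 1) * s⌋₊) atTop (𝓝[≥] s) := by
  have hle : ∀ n : ℕ, s ≤ gridUpper T n ⌊((n : ℝ≥0) + 1) * s⌋₊ := fun n => by
    refine le_min hs ?_
    rw [le_div_iff₀ (by positivity), mul_comm]
    exact (Nat.lt_floor_add_one _).le
  refine tendsto_nhdsWithin_iff.2 ⟨?_, Eventually.of_forall hle⟩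
  refine tendsto_of_tendsto_of_tendsto_of_le_of_le tendsto_const_nhds
    (h := fun n : ℕ => s + 1 / ((n : ℝ≥0) + 1)) ?_ hle fun n => ?_
  · simpa using (tendsto_const_nhds (x := s)).add
      (tendsto_one_div_add_atTop_nhds_zero_nat (𝕜 := ℝ≥0))
  · refine (min_le_right _ _).trans ?_
    rw [add_div]
    refine add_le_add_left ?_ _
    rw [div_le_iff₀ (by positivity), mul_comm]
    exact Nat.floor_le (by positivity)

variable [MeasurableSpace S] [MeasurableSingletonClass S]

/-- Progressive measurability of the occupation indicator. -/
lemma measurable_indicator_occupation [MeasurableSpace Ω]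
    (hc : ∀ ω t, ∀ᶠ s in 𝓝[≥] t, X s ω = X t ω) (T : ℝ≥0) (hm : ∀ u ≤ T, Measurable (X u)) :
    Measurable fun q : ℝ × Ω =>
      (Set.Iio (T : ℝ)).indicator (fun s => occupation X i s q.2) q.1 := by
  -- With a countable time index, joint measurability follows from measurability at each time; the
  -- floor map then carries it over to real times.
  have hg : ∀ n : ℕ, Measurable fun q : ℕ × Ω =>
      Set.indicator {i} (fun _ => (1 : ℝ)) (X (gridUpper T n q.1) q.2) := fun n =>
    measurable_from_prod_countable_right fun k =>
      (measurable_const.indicator (measurableSet_singleton i)).comp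
        (hm (gridUpper T n k) (min_le_left _ _))
  refine measurable_of_tendsto_metrizable (f := fun (n : ℕ) (q : ℝ × Ω) =>
    (Set.Iio (T : ℝ)).indicator (fun s => Set.indicator {i} (fun _ => (1 : ℝ))
      (X (gridUpper T n ⌊((n : ℝ≥0) + 1) * s.toNNReal⌋₊) q.2)) q.1) (fun n => ?_) ?_
  · have h1 : ∀ k : ℝ → ℕ, Measurable k → Measurable fun q : ℝ × Ω =>
        Set.indicator {i} (fun _ => (1 : ℝ)) (X (gridUpper T n (k q.1)) q.2) := fun k hk => by
      have h3 : Measurable fun q : ℝ × Ω => (k q.1, q.2) :=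
        (hk.comp measurable_fst).prodMk measurable_snd
      have h4 := (hg n).comp h3
      simp only [Function.comp_def] at h4
      exact h4
    have h2 : Measurable fun s : ℝ => ⌊((n : ℝ≥0) + 1) * s.toNNReal⌋₊ :=
      (measurable_real_toNNReal.const_mul _).nat_floor
    exact (h1 _ h2).indicator (measurableSet_Iio.preimage measurable_fst)
  · rw [tendsto_pi_nhds]
    rintro ⟨s, ω⟩
    by_cases hs : s < T
    · simp only [Set.indicator_of_mem (Set.mem_Iio.2 hs)]
      have hle : s.toNNReal ≤ T := Real.toNNReal_le_iff_le_coe.2 hs.le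
      refine tendsto_const_nhds.congr' ?_
      filter_upwards [(tendsto_gridUpper hle).eventually (hc ω s.toNNReal)] with n hn
      rw [hn, occupation]
    · simp [Set.indicator_of_notMem (show s ∉ Set.Iio (T : ℝ) from hs)]

lemma measurable_occupation [MeasurableSpace Ω] (hc : ∀ ω t, ∀ᶠ s in 𝓝[≥] t, X s ω = X t ω)
    (hm : ∀ u, Measurable (X u)) : Measurable fun q : ℝ × Ω => occupation X i q.1 q.2 := by
  refine measurable_of_tendsto_metrizable (f := fun (n : ℕ) (q : ℝ × Ω) =>
    (Set.Iio (((n : ℝ≥0) : ℝ))).indicator (fun s => occupation X i s q.2) q.1)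
    (fun n => measurable_indicator_occupation hc n fun u _ => hm u) ?_
  rw [tendsto_pi_nhds]
  rintro ⟨s, ω⟩
  refine tendsto_const_nhds.congr' ?_
  filter_upwards [eventually_gt_atTop ⌈s⌉₊] with n hn
  rw [Set.indicator_of_mem]
  exact (Nat.le_ceil s).trans_lt (by exact_mod_cast hn)

/-- The local time up to time `t` only depends on the path up to time `t`. -/
lemma measurable_localTime [MeasurableSpace Ω] (hc : ∀ ω t, ∀ᶠ s in 𝓝[≥] t, X s ω = X t ω)
    (t : ℝ≥0) (hm : ∀ u ≤ t, Measurable (X u)) : Measurable (localTime X i t) := by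
  have h := (measurable_indicator_occupation (i := i) hc t hm).stronglyMeasurable
  have h2 := (h.comp_measurable measurable_swap).integral_prod_right'
    (ν := volume.restrict (Set.Ioo (0 : ℝ) t))
  convert h2.measurable using 1
  ext ω
  rw [localTime_eq, intervalIntegral.integral_of_le t.coe_nonneg, integral_Ioc_eq_integral_Ioo]
  refine setIntegral_congr_fun measurableSet_Ioo fun s hs => ?_
  simp [Set.indicator_of_mem (Set.mem_Iio.2 hs.2)]

variable [MeasurableSpace Ω] (hc : ∀ ω t, ∀ᶠ s in 𝓝[≥] t, X s ω = X t ω)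
  (hm : ∀ u, Measurable (X u))

include hc hm

lemma measurable_occupation_path (ω : Ω) : Measurable fun s => occupation X i s ω :=
  (measurable_occupation hc hm).comp (measurable_id.prodMk measurable_const)

lemma intervalIntegrable_occupation (ω : Ω) (a b : ℝ) :
    IntervalIntegrable (fun s => occupation X i s ω) volume a b := by
  refine (intervalIntegrable_const (c := (1 : ℝ))).mono_fun
    (measurable_occupation_path hc hm ω).aestronglyMeasurable (ae_of_all _ fun s => ?_)
  simpa [abs_of_nonneg (occupation_nonneg s ω)] using occupation_le_one s ω

lemma continuous_integral_occupation (ω : Ω) :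
    Continuous fun t : ℝ => ∫ s in (0 : ℝ)..t, occupation X i s ω :=
  intervalIntegral.continuous_primitive (intervalIntegrable_occupation hc hm ω) 0

lemma localTime_le (t : ℝ≥0) (ω : Ω) : localTime X i t ω ≤ t := by
  have := intervalIntegral.integral_mono_on t.2 (intervalIntegrable_occupation (i := i) hc hm ω 0 t)
    (intervalIntegrable_const (c := (1 : ℝ))) fun s _ => occupation_le_one s ω
  simpa [localTime_eq] using this

lemma measurable_uncurry_localTime :
    Measurable fun q : ℝ × Ω => localTime X i q.1.toNNReal q.2 := by
  refine (stronglyMeasurable_uncurry_of_continuous_of_stronglyMeasurable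
    (u := fun (s : ℝ) (ω : Ω) => localTime X i s.toNNReal ω) (fun ω => ?_)
    fun s => ?_).measurable
  · exact (continuous_integral_occupation hc hm ω).comp
      (NNReal.continuous_coe.comp continuous_real_toNNReal)
  · exact (measurable_localTime hc _ fun u _ => hm u).stronglyMeasurable

/-- The occupation indicator is only right-continuous, so only a right derivative is available at
every time. For a continuous function this is enough for the fundamental theorem of calculus. -/
lemma hasDerivWithinAt_integral_occupation (ω : Ω) (t : ℝ) :
    HasDerivWithinAt (fun t : ℝ => ∫ s in (0 : ℝ)..t, occupation X i s ω)
      (occupation X i t ω) (Set.Ioi t) t := by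
  have hcont : ContinuousWithinAt (fun s => occupation X i s ω) (Set.Ioi t) t := by
    refine tendsto_const_nhds.congr' ?_
    have h1 : Tendsto Real.toNNReal (𝓝[>] t) (𝓝[≥] t.toNNReal) :=
      tendsto_nhdsWithin_iff.2 ⟨(continuous_real_toNNReal.tendsto t).mono_left nhdsWithin_le_nhds,
        by filter_upwards [self_mem_nhdsWithin] with s hs
           exact Real.toNNReal_le_toNNReal (le_of_lt hs)⟩
    filter_upwards [h1.eventually (hc ω t.toNNReal)] with s hs
    simp only [occupation, hs]
  exact (intervalIntegral.integral_hasDerivWithinAt_right (s := Set.Ici t) (t := Set.Ioi t)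
    (intervalIntegrable_occupation hc hm ω 0 t)
    (measurable_occupation_path hc hm ω).stronglyMeasurable.stronglyMeasurableAtFilter
    hcont).mono Set.Ioi_subset_Ici_self

/-- The integrated form of `d exp (κ L_t) = κ 1_{X_t = i} exp (κ L_t) dt`. -/
lemma exp_localTime_eq {κ : ℝ} (hκ : 0 < κ) (ω : Ω) {t : ℝ} (ht : 0 ≤ t) :
    ENNReal.ofReal (Real.exp (κ * localTime X i t.toNNReal ω)) =
      1 + ENNReal.ofReal κ * ∫⁻ s in Set.Ioc 0 t, ENNReal.ofReal (occupation X i s ω) *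
        ENNReal.ofReal (Real.exp (κ * localTime X i s.toNNReal ω)) := by
  set J : ℝ → ℝ := fun t => ∫ s in (0 : ℝ)..t, occupation X i s ω with hJ
  have hJL : ∀ s, 0 ≤ s → localTime X i s.toNNReal ω = J s := fun s hs => by
    rw [localTime_eq, Real.coe_toNNReal s hs]
  have hJc : Continuous J := continuous_integral_occupation hc hm ω
  have h_int : IntervalIntegrable (fun s => Real.exp (κ * J s) * (κ * occupation X i s ω))
      volume 0 t :=
    ((intervalIntegrable_occupation hc hm ω 0 t).const_mul κ).continuousOn_mul
      (by fun_prop : Continuous fun s => Real.exp (κ * J s)).continuousOn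
  have hftc := intervalIntegral.integral_eq_sub_of_hasDeriv_right_of_le ht
    (f := fun s => Real.exp (κ * J s)) (f' := fun s => Real.exp (κ * J s) *
      (κ * occupation X i s ω)) (by fun_prop) (fun s _ =>
      ((hasDerivWithinAt_integral_occupation hc hm ω s).const_mul κ).exp) h_int
  have hJ0 : J 0 = 0 := by simp [hJ]
  rw [hJ0, mul_zero, Real.exp_zero, intervalIntegral.integral_of_le ht] at hftc
  have hnn : ∀ s, 0 ≤ Real.exp (κ * J s) * (κ * occupation X i s ω) := fun s =>
    mul_nonneg (Real.exp_pos _).le (mul_nonneg hκ.le (occupation_nonneg s ω))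
  have h2 : ENNReal.ofReal κ * ∫⁻ s in Set.Ioc 0 t, ENNReal.ofReal (occupation X i s ω) *
      ENNReal.ofReal (Real.exp (κ * localTime X i s.toNNReal ω)) =
      ENNReal.ofReal (∫ s in Set.Ioc 0 t, Real.exp (κ * J s) * (κ * occupation X i s ω)) := by
    rw [ofReal_integral_eq_lintegral_ofReal
      ((intervalIntegrable_iff_integrableOn_Ioc_of_le ht).1 h_int) (ae_of_all _ hnn),
      ← lintegral_const_mul' _ _ ENNReal.ofReal_ne_top]
    refine setLIntegral_congr_fun measurableSet_Ioc fun s hs => ?_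
    simp only [hJL s hs.1.le]
    rw [← ENNReal.ofReal_mul (occupation_nonneg s ω), ← ENNReal.ofReal_mul hκ.le]
    congr 1
    ring
  rw [h2, ← ENNReal.ofReal_one, ← ENNReal.ofReal_add zero_le_one (integral_nonneg hnn), hftc,
    hJL t ht]
  congr 1
  ring

end Occupation

/-! ### From the Markov property to the renewal equation -/

/-- Interchange of integration in an iterated convolution on the half-line. -/
lemma lintegral_convolution {f g : ℝ → ℝ≥0∞} (hf : Measurable f) (hg : Measurable g) (t : ℝ) :
    ∫⁻ s in Set.Ioc 0 t, ∫⁻ w in Set.Ioc 0 s, f w * g (s - w) =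
      ∫⁻ v in Set.Ioc 0 t, g v * ∫⁻ w in Set.Ioc 0 (t - v), f w := by
  set A : Set (ℝ × ℝ) := {q | q.1 ≤ t ∧ 0 < q.2 ∧ q.2 ≤ q.1} with hA
  have hAm : MeasurableSet A :=
    (measurableSet_le measurable_fst measurable_const).inter
      ((measurableSet_lt measurable_const measurable_snd).inter
        (measurableSet_le measurable_snd measurable_fst))
  set F : ℝ × ℝ → ℝ≥0∞ := A.indicator fun q => f q.2 * g (q.1 - q.2) with hF
  have hFm : Measurable F := by
    refine Measurable.indicator ?_ hAm
    exact (hf.comp measurable_snd).mul (hg.comp (measurable_fst.sub measurable_snd))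
  have h1 : ∫⁻ s in Set.Ioc 0 t, ∫⁻ w in Set.Ioc 0 s, f w * g (s - w) =
      ∫⁻ s, ∫⁻ w, F (s, w) := by
    rw [← lintegral_indicator measurableSet_Ioc]
    refine lintegral_congr fun s => ?_
    by_cases hs : s ∈ Set.Ioc 0 t
    · rw [Set.indicator_of_mem hs, ← lintegral_indicator measurableSet_Ioc]
      refine lintegral_congr fun w => ?_
      by_cases hw : w ∈ Set.Ioc 0 s
      · rw [Set.indicator_of_mem hw, hF, Set.indicator_of_mem (show (s, w) ∈ A from
          ⟨hs.2, hw.1, hw.2⟩)]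
      · rw [Set.indicator_of_notMem hw, hF, Set.indicator_of_notMem (show (s, w) ∉ A from
          fun h => hw ⟨h.2.1, h.2.2⟩)]
    · rw [Set.indicator_of_notMem hs]
      symm
      rw [lintegral_eq_zero_iff (by fun_prop)]
      refine Eventually.of_forall fun w => ?_
      change F (s, w) = 0
      rw [hF, Set.indicator_of_notMem (show (s, w) ∉ A from
        fun h => hs ⟨h.2.1.trans_le h.2.2, h.1⟩)]
  -- The substitution s = v + w: Tonelli twice, with translation invariance in between.
  have h2 : ∫⁻ s, ∫⁻ w, F (s, w) = ∫⁻ v, ∫⁻ w, F (v + w, w) := by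
    rw [lintegral_lintegral_swap (f := fun s w => F (s, w)) hFm.aemeasurable]
    rw [lintegral_lintegral_swap (f := fun v w => F (v + w, w)) (by
      have : Measurable fun q : ℝ × ℝ => F (q.1 + q.2, q.2) := by fun_prop
      exact this.aemeasurable)]
    exact lintegral_congr fun w => (lintegral_add_right_eq_self (fun s => F (s, w)) w).symm
  rw [h1, h2, ← lintegral_indicator measurableSet_Ioc]
  refine lintegral_congr_ae ?_
  -- The region w ≤ s contains the line v = 0, which the half-open interval for v omits.
  have hne : ∀ᵐ v : ℝ, v ≠ 0 := by simp [ae_iff, measure_singleton]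
  filter_upwards [hne] with v hv0
  by_cases hv : v ∈ Set.Ioc 0 t
  · rw [Set.indicator_of_mem hv, ← lintegral_const_mul _ hf,
      ← lintegral_indicator measurableSet_Ioc]
    refine lintegral_congr fun w => ?_
    by_cases hw : w ∈ Set.Ioc 0 (t - v)
    · rw [Set.indicator_of_mem hw, hF, Set.indicator_of_mem (show (v + w, w) ∈ A from
        ⟨by linarith [hw.2], hw.1, by linarith [hv.1]⟩), add_sub_cancel_right, mul_comm]
    · rw [Set.indicator_of_notMem hw, hF, Set.indicator_of_notMem (show (v + w, w) ∉ A from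
        fun h => hw ⟨h.2.1, by have := h.1; simp only at this; linarith⟩)]
  · rw [Set.indicator_of_notMem hv, lintegral_eq_zero_iff (by fun_prop)]
    refine Eventually.of_forall fun w => ?_
    change F (v + w, w) = 0
    refine Set.indicator_of_notMem (fun h => hv ?_) _
    have h3 := h.1
    have h4 := h.2.1
    have h5 := h.2.2
    simp only at h3 h4 h5
    exact ⟨lt_of_le_of_ne (by linarith) (Ne.symm hv0), by linarith⟩

namespace IsMarkovProcess

variable {S Ω : Type*} [MeasurableSpace S] [MeasurableSingletonClass S]
  [MeasurableSpace Ω] {a : S → S → ℝ} {P : S → Measure Ω} {X : ℝ≥0 → Ω → S}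
  (hX : IsMarkovProcess a P X)

include hX

lemma measurableSet_state (t : ℝ≥0) (k : S) : MeasurableSet {ω | X t ω = k} :=
  hX.measurable t (measurableSet_singleton k)

omit [MeasurableSingletonClass S] in
/-- The Markov property for functionals of the past. -/
lemma lintegral_markov (s t : ℝ≥0) (j k l : S) {Z : Ω → ℝ≥0∞}
    (hZ : Measurable[⨆ u : Set.Iic s, MeasurableSpace.comap (X u) inferInstance] Z) :
    ∫⁻ ω in {ω | X s ω = k} ∩ {ω | X (s + t) ω = l}, Z ω ∂(P j) =
      (∫⁻ ω in {ω | X s ω = k}, Z ω ∂(P j)) * P k {ω | X t ω = l} := by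
  have hle : (⨆ u : Set.Iic s, MeasurableSpace.comap (X u) inferInstance) ≤
      (inferInstance : MeasurableSpace Ω) :=
    iSup_le fun u => (hX.measurable u).comap_le
  have := hX.isProbabilityMeasure
  rw [← lintegral_trim hle hZ, ← lintegral_trim hle hZ, mul_comm, ← smul_eq_mul,
    ← lintegral_smul_measure]
  congr 1
  -- For fixed states, the Markov property on past events says that two measures agree on the past
  -- σ-algebra; integrating Z against them gives the claim.
  refine @Measure.ext Ω (⨆ u : Set.Iic s, MeasurableSpace.comap (X u) inferInstance) _ _
    fun A hA => ?_
  rw [trim_measurableSet_eq hle hA, Measure.smul_apply, trim_measurableSet_eq hle hA,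
    Measure.restrict_apply (hle A hA), Measure.restrict_apply (hle A hA), ← Set.inter_assoc,
    hX.markov s t A hA, smul_eq_mul, mul_comm]

lemma measurable_transProb (i : S) : Measurable fun t : ℝ => transProb P X t.toNNReal i i := by
  have := hX.isProbabilityMeasure i
  have h := ((measurable_occupation (i := i) hX.right_continuous
    hX.measurable).stronglyMeasurable.integral_prod_right' (ν := P i)).measurable
  convert h using 1
  ext t
  have : ∀ ω, occupation X i t ω = {ω | X t.toNNReal ω = i}.indicator 1 ω := fun ω => by
    by_cases h : X t.toNNReal ω = i <;> simp [occupation, h]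
  simp only [this]
  rw [integral_indicator_one (hX.measurableSet_state _ _)]
  rfl

/-- Continuity at 0 comes from the finite exit rate: 1 - p(t) is t times a quotient that converges.
-/
lemma isReturnProfile (i : S) : IsReturnProfile fun t : ℝ => transProb P X t.toNNReal i i where
  measurable := hX.measurable_transProb i
  nonneg _ := measureReal_nonneg
  le_one _ := by
    have := hX.isProbabilityMeasure i
    exact measureReal_le_one
  tendsto_zero := by
    have h0 : Tendsto (fun t : ℝ≥0 => (t : ℝ)) (𝓝[>] 0) (𝓝 0) :=
      (NNReal.continuous_coe.tendsto 0).mono_left nhdsWithin_le_nhds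
    have h1 := (tendsto_const_nhds (x := (1 : ℝ))).sub ((hX.rate_diag i).mul h0)
    rw [mul_zero, sub_zero] at h1
    have h2 : Tendsto (fun t : ℝ≥0 => transProb P X t i i) (𝓝[>] 0) (𝓝 1) := by
      refine h1.congr' ?_
      filter_upwards [self_mem_nhdsWithin] with t ht
      have : (t : ℝ) ≠ 0 := by exact_mod_cast (ne_of_gt ht)
      field_simp
      ring
    refine h2.comp (tendsto_nhdsWithin_iff.2 ⟨?_, ?_⟩)
    · simpa using (continuous_real_toNNReal.tendsto 0).mono_left nhdsWithin_le_nhds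
    · filter_upwards [self_mem_nhdsWithin] with t ht
      exact Real.toNNReal_pos.2 ht

omit [MeasurableSingletonClass S] in
lemma ofReal_transProb (t : ℝ≥0) (i : S) :
    ENNReal.ofReal (transProb P X t i i) = P i {ω | X t ω = i} := by
  have := hX.isProbabilityMeasure i
  exact ENNReal.ofReal_toReal (measure_ne_top _ _)

variable {κ : ℝ} (hκ : 0 < κ) (i : S)

/-- `measurable_localTime` is applied with the past σ-algebra as the ambient one on Ω. This admits
exp(κ L_s) as the functional Z in `lintegral_markov`. -/
lemma measurable_exp_localTime_past (κ : ℝ) (t : ℝ≥0) :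
    Measurable[⨆ u : Set.Iic t, MeasurableSpace.comap (X u) inferInstance]
      fun ω => ENNReal.ofReal (Real.exp (κ * localTime X i t ω)) := by
  have h : Measurable[⨆ u : Set.Iic t, MeasurableSpace.comap (X u) inferInstance]
      (localTime X i t) := by
    refine @measurable_localTime S Ω X i _ _
      (⨆ u : Set.Iic t, MeasurableSpace.comap (X u) inferInstance) hX.right_continuous t ?_
    intro u hu
    exact (comap_measurable (X u)).mono
      (le_iSup (fun u : Set.Iic t => MeasurableSpace.comap (X u) inferInstance) ⟨u, hu⟩) le_rfl
  exact ((h.const_mul κ).exp).ennreal_ofReal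

lemma measurable_occupation_mul_exp (κ : ℝ) :
    Measurable fun q : ℝ × Ω => ENNReal.ofReal (occupation X i q.1 q.2) *
      ENNReal.ofReal (Real.exp (κ * localTime X i q.1.toNNReal q.2)) :=
  (measurable_occupation hX.right_continuous hX.measurable).ennreal_ofReal.mul
    (((measurable_uncurry_localTime hX.right_continuous
      hX.measurable).const_mul κ).exp).ennreal_ofReal

/-- Measurability in time of the exponential moment restricted to `X_s = i`. -/
lemma measurable_lintegral_occupation_mul_exp (κ : ℝ) :
    Measurable fun s : ℝ => ∫⁻ ω, ENNReal.ofReal (occupation X i s ω) *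
      ENNReal.ofReal (Real.exp (κ * localTime X i s.toNNReal ω)) ∂(P i) := by
  have := hX.isProbabilityMeasure i
  exact (hX.measurable_occupation_mul_exp i κ).lintegral_prod_right'

include hκ

lemma lintegral_exp_localTime {t : ℝ} (ht : 0 ≤ t) :
    ∫⁻ ω, ENNReal.ofReal (Real.exp (κ * localTime X i t.toNNReal ω)) ∂(P i) =
      1 + ENNReal.ofReal κ * ∫⁻ s in Set.Ioc 0 t, ∫⁻ ω, ENNReal.ofReal (occupation X i s ω) *
        ENNReal.ofReal (Real.exp (κ * localTime X i s.toNNReal ω)) ∂(P i) := by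
  have := hX.isProbabilityMeasure i
  simp only [exp_localTime_eq hX.right_continuous hX.measurable hκ _ ht]
  rw [lintegral_add_left measurable_const, lintegral_const, measure_univ, mul_one,
    lintegral_const_mul' _ _ ENNReal.ofReal_ne_top, lintegral_lintegral_swap]
  exact ((hX.measurable_occupation_mul_exp i κ).comp measurable_swap).aemeasurable

/-- The Volterra equation for the exponential moment restricted to `X_t = i`. -/
lemma lintegral_occupation_mul_exp {t : ℝ} (ht : 0 ≤ t) :
    ∫⁻ ω, ENNReal.ofReal (occupation X i t ω) *
        ENNReal.ofReal (Real.exp (κ * localTime X i t.toNNReal ω)) ∂(P i) =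
      ENNReal.ofReal (transProb P X t.toNNReal i i) + ENNReal.ofReal κ * ∫⁻ s in Set.Ioc 0 t,
        (∫⁻ ω, ENNReal.ofReal (occupation X i s ω) *
          ENNReal.ofReal (Real.exp (κ * localTime X i s.toNNReal ω)) ∂(P i)) *
          ENNReal.ofReal (transProb P X (t - s).toNNReal i i) := by
  have := hX.isProbabilityMeasure i
  have hocc : Measurable fun ω => ENNReal.ofReal (occupation X i t ω) :=
    ((measurable_occupation hX.right_continuous hX.measurable).comp
      (measurable_const.prodMk measurable_id)).ennreal_ofReal
  have hset : ∀ (u : ℝ) (Z : Ω → ℝ≥0∞), ∫⁻ ω, ENNReal.ofReal (occupation X i u ω) * Z ω ∂(P i) =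
      ∫⁻ ω in {ω | X u.toNNReal ω = i}, Z ω ∂(P i) := fun u Z => by
    rw [← lintegral_indicator (hX.measurableSet_state _ _)]
    refine lintegral_congr fun ω => ?_
    rw [ofReal_occupation]
    by_cases h : X u.toNNReal ω = i <;> simp [h]
  calc _ = ∫⁻ ω, (ENNReal.ofReal (occupation X i t ω) + ENNReal.ofReal κ *
        ∫⁻ s in Set.Ioc 0 t, ENNReal.ofReal (occupation X i t ω) *
          (ENNReal.ofReal (occupation X i s ω) *
            ENNReal.ofReal (Real.exp (κ * localTime X i s.toNNReal ω)))) ∂(P i) := by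
        refine lintegral_congr fun ω => ?_
        rw [exp_localTime_eq hX.right_continuous hX.measurable hκ _ ht, mul_add, mul_one,
          mul_left_comm, ← lintegral_const_mul' _ _ ENNReal.ofReal_ne_top]
    _ = _ := by
        rw [lintegral_add_left hocc, lintegral_const_mul' _ _ ENNReal.ofReal_ne_top,
          lintegral_lintegral_swap]
        · congr 1
          · have := hset t fun _ => 1
            simp only [mul_one] at this
            rw [this, hX.ofReal_transProb]
            simp
          · congr 1
            refine setLIntegral_congr_fun measurableSet_Ioc fun s hs => ?_
            -- The Markov property at time s detaches the return probability over the remaining time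
            -- t - s.
            have hst : s.toNNReal + (t - s).toNNReal = t.toNNReal := by
              rw [← Real.toNNReal_add hs.1.le (sub_nonneg.2 hs.2), add_sub_cancel]
            rw [hset t, hset s, hX.ofReal_transProb, ← hX.lintegral_markov s.toNNReal
              (t - s).toNNReal i i i (hX.measurable_exp_localTime_past i κ s.toNNReal), hst,
              ← lintegral_indicator (hX.measurableSet_state _ _), ← lintegral_indicator
              ((hX.measurableSet_state _ _).inter (hX.measurableSet_state _ _))]
            refine lintegral_congr fun ω => ?_
            simp only [ofReal_occupation]
            by_cases h1 : X s.toNNReal ω = i <;> by_cases h2 : X t.toNNReal ω = i <;>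
              simp [h1, h2]
        · have h1 := (hX.measurable_occupation_mul_exp i κ).comp
            (measurable_swap (α := Ω) (β := ℝ))
          exact ((hocc.comp measurable_fst).mul h1).aemeasurable

/-- Let U(s) be the moment restricted to X_s = i. Then M = 1 + κ∫U and U = p + κ U * p. Integrating
the second relation and exchanging the order of integration leaves p(v)(1 + κ∫U over (0, t-v]), and
the bracket is M(t-v). -/
lemma lintegral_renewal {t : ℝ} (ht : 0 ≤ t) :
    ∫⁻ ω, ENNReal.ofReal (Real.exp (κ * localTime X i t.toNNReal ω)) ∂(P i) =
      1 + ENNReal.ofReal κ * ∫⁻ v in Set.Ioc 0 t,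
        ENNReal.ofReal (transProb P X v.toNNReal i i) *
        ∫⁻ ω, ENNReal.ofReal (Real.exp (κ * localTime X i (t - v).toNNReal ω)) ∂(P i) := by
  have hU := hX.measurable_lintegral_occupation_mul_exp i κ
  have hpm := (hX.measurable_transProb i).ennreal_ofReal
  rw [hX.lintegral_exp_localTime hκ i ht]
  congr 2
  rw [setLIntegral_congr_fun measurableSet_Ioc fun s hs =>
    hX.lintegral_occupation_mul_exp hκ i hs.1.le, lintegral_add_left hpm,
    lintegral_const_mul' _ _ ENNReal.ofReal_ne_top, lintegral_convolution hU hpm,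
    ← lintegral_const_mul' _ _ ENNReal.ofReal_ne_top, ← lintegral_add_left hpm]
  refine setLIntegral_congr_fun measurableSet_Ioc fun v hv => ?_
  rw [hX.lintegral_exp_localTime hκ i (sub_nonneg.2 hv.2), mul_add, mul_one, mul_left_comm]

omit hκ in
lemma integrable_exp_localTime (κ : ℝ) (t : ℝ≥0) :
    Integrable (fun ω => Real.exp (κ * localTime X i t ω)) (P i) := by
  have := hX.isProbabilityMeasure i
  refine Integrable.of_bound (C := Real.exp (|κ| * t)) (((measurable_localTime
    hX.right_continuous t fun u _ => hX.measurable u).const_mul κ).exp).aestronglyMeasurable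
    (ae_of_all _ fun ω => ?_)
  rw [Real.norm_eq_abs, Real.abs_exp]
  refine Real.exp_le_exp.2 ?_
  have h0 := localTime_nonneg (X := X) (i := i) t ω
  exact mul_le_mul (le_abs_self κ) (localTime_le hX.right_continuous hX.measurable t ω) h0
    (abs_nonneg κ)

omit hκ in
lemma ofReal_expMoment (κ : ℝ) (t : ℝ≥0) :
    ENNReal.ofReal (expMoment P X i κ t) =
      ∫⁻ ω, ENNReal.ofReal (Real.exp (κ * localTime X i t ω)) ∂(P i) :=
  ofReal_integral_eq_lintegral_ofReal (hX.integrable_exp_localTime i κ t)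
    (ae_of_all _ fun _ => (Real.exp_pos _).le)

lemma isRenewalSolution : IsRenewalSolution (fun t : ℝ => transProb P X t.toNNReal i i) κ
    fun t : ℝ => expMoment P X i κ t.toNNReal where
  measurable := by
    have := hX.isProbabilityMeasure i
    exact ((((measurable_uncurry_localTime (i := i) hX.right_continuous
      hX.measurable).const_mul κ).exp).stronglyMeasurable.integral_prod_right'
        (ν := P i)).measurable
  one_le t _ := by
    have := hX.isProbabilityMeasure i
    have h : ∫ _, (1 : ℝ) ∂(P i) ≤ expMoment P X i κ t.toNNReal := by
      refine integral_mono (integrable_const 1) (hX.integrable_exp_localTime i κ _) fun ω => ?_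
      exact Real.one_le_exp (mul_nonneg hκ.le
        (localTime_nonneg _ ω))
    simpa using h
  le_exp t ht := by
    have := hX.isProbabilityMeasure i
    have h : expMoment P X i κ t.toNNReal ≤ ∫ _, Real.exp (κ * t) ∂(P i) := by
      refine integral_mono (hX.integrable_exp_localTime i κ _) (integrable_const _) fun ω => ?_
      refine Real.exp_le_exp.2 (mul_le_mul_of_nonneg_left ?_ hκ.le)
      have := localTime_le (i := i) hX.right_continuous hX.measurable t.toNNReal ω
      rwa [Real.coe_toNNReal t ht] at this
    simpa using h
  renewal t ht := by
    have hM0 : ∀ s : ℝ≥0, 0 ≤ expMoment P X i κ s := fun s =>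
      integral_nonneg fun _ => (Real.exp_pos _).le
    have h := hX.lintegral_renewal hκ i ht
    simp only [← hX.ofReal_expMoment, ← ENNReal.ofReal_mul (measureReal_nonneg :
      0 ≤ (P i).real _), transProb] at h
    have hmeas : AEStronglyMeasurable (fun v : ℝ => transProb P X v.toNNReal i i *
        expMoment P X i κ (t - v).toNNReal) (volume.restrict (Set.Ioc 0 t)) := by
      have := hX.isProbabilityMeasure i
      have h1 := ((((measurable_uncurry_localTime (i := i) hX.right_continuous
        hX.measurable).const_mul κ).exp).stronglyMeasurable.integral_prod_right'
        (ν := P i)).measurable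
      exact ((hX.measurable_transProb i).mul
        (h1.comp (measurable_const.sub measurable_id))).aestronglyMeasurable
    have hnn : ∀ v : ℝ, 0 ≤ transProb P X v.toNNReal i i * expMoment P X i κ (t - v).toNNReal :=
      fun v => mul_nonneg measureReal_nonneg (hM0 _)
    rw [integral_eq_lintegral_of_nonneg_ae (ae_of_all _ hnn) hmeas]
    -- Finiteness is read off the equation itself: its left side is an `ENNReal.ofReal`.
    have hfin : ENNReal.ofReal κ * ∫⁻ v in Set.Ioc 0 t, ENNReal.ofReal
        (transProb P X v.toNNReal i i * expMoment P X i κ (t - v).toNNReal) ≠ ⊤ := by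
      intro htop
      simp only [transProb] at htop
      rw [htop] at h
      simp at h
    have h2 := congrArg ENNReal.toReal h
    simp only [transProb] at hfin
    rw [ENNReal.toReal_ofReal (hM0 _), ENNReal.toReal_add ENNReal.one_ne_top hfin,
      ENNReal.toReal_mul, ENNReal.toReal_ofReal hκ.le, ENNReal.toReal_one] at h2
    exact h2

lemma tendsto_log_expMoment :
    Tendsto (fun t : ℝ≥0 => (1 / (t : ℝ)) * Real.log (expMoment P X i κ t)) atTop
      (𝓝 (rate (fun t : ℝ => transProb P X t.toNNReal i i) κ)) := by
  have h := ((hX.isRenewalSolution hκ i).tendsto_log_div (hX.isReturnProfile i) hκ).comp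
    (NNReal.tendsto_coe_atTop.2 tendsto_id)
  simpa [Function.comp_def] using h

end IsMarkovProcess

/-! ### Abelian theorems for general kernels -/

lemma integrableOn_Ioi_zero_of_bounded_of_rpow {f : ℝ → ℝ} (hf : Measurable f) {A B β : ℝ}
    (hβ : 1 < β) (h0 : ∀ t ∈ Set.Ioc (0 : ℝ) 1, |f t| ≤ A)
    (h1 : ∀ t ∈ Set.Ioi (1 : ℝ), |f t| ≤ B * t ^ (-β)) : IntegrableOn f (Set.Ioi 0) := by
  rw [← Set.Ioc_union_Ioi_eq_Ioi (zero_le_one (α := ℝ))]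
  refine IntegrableOn.union ?_ ?_
  · refine Measure.integrableOn_of_bounded (M := A) (by simp) hf.aestronglyMeasurable ?_
    filter_upwards [ae_restrict_mem measurableSet_Ioc] with t ht
    exact h0 t ht
  · refine Integrable.mono' ((integrableOn_Ioi_rpow_of_lt (a := -β) (by linarith)
      one_pos).const_mul B) hf.aestronglyMeasurable ?_
    filter_upwards [ae_restrict_mem measurableSet_Ioi] with t ht
    exact h1 t ht

/-- An Abelian theorem for a general kernel. -/
lemma tendsto_scaled_integral {p K : ℝ → ℝ} {α c C : ℝ} (hpm : Measurable p)
    (hp0 : ∀ t, 0 ≤ p t) (hpC : ∀ t, 0 < t → p t * t ^ α ≤ C)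
    (htail : Tendsto (fun t => p t * t ^ α) atTop (𝓝 c))
    (hKm : Measurable K) (hK0 : ∀ s, 0 < s → 0 ≤ K s)
    (hK : IntegrableOn (fun s => K s * s ^ (-α)) (Set.Ioi 0)) :
    Tendsto (fun l : ℝ => l ^ (1 - α) * ∫ t in Set.Ioi (0 : ℝ), K (l * t) * p t) (𝓝[>] 0)
      (𝓝 (c * ∫ s in Set.Ioi (0 : ℝ), K s * s ^ (-α))) := by
  have hlim : Tendsto (fun l : ℝ => ∫ s in Set.Ioi (0 : ℝ), K s * (l ^ (-α) * p (s / l)))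
      (𝓝[>] 0) (𝓝 (∫ s in Set.Ioi (0 : ℝ), c * (K s * s ^ (-α)))) := by
    -- After the substitution s = lt the first two factors on the right tend to c and are bounded by
    -- C uniformly in l, so a multiple of K(s) s^(-α) dominates.
    have hid : ∀ l > 0, ∀ s > 0, l ^ (-α) * p (s / l) = p (s / l) * (s / l) ^ α * s ^ (-α) := by
      intro l hl s hs
      rw [Real.div_rpow hs.le hl.le, Real.rpow_neg hl.le, Real.rpow_neg hs.le]
      have h1 := (Real.rpow_pos_of_pos hs α).ne'
      have h2 := (Real.rpow_pos_of_pos hl α).ne'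
      field_simp
    refine tendsto_integral_filter_of_dominated_convergence (fun s => C * (K s * s ^ (-α)))
      ?_ ?_ (hK.const_mul C) ?_
    · exact Eventually.of_forall fun l => (by fun_prop : Measurable _).aestronglyMeasurable
    · filter_upwards [self_mem_nhdsWithin] with l hl
      filter_upwards [ae_restrict_mem measurableSet_Ioi] with s hs
      have hsl : 0 < s / l := div_pos hs hl
      rw [hid l hl s hs, Real.norm_eq_abs, abs_of_nonneg (mul_nonneg (hK0 s hs) (mul_nonneg
        (mul_nonneg (hp0 _) (Real.rpow_nonneg hsl.le _)) (Real.rpow_nonneg (le_of_lt hs) _)))]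
      calc _ ≤ K s * (C * s ^ (-α)) := mul_le_mul_of_nonneg_left (mul_le_mul_of_nonneg_right
              (hpC _ hsl) (Real.rpow_nonneg (le_of_lt hs) _)) (hK0 s hs)
        _ = _ := by ring
    · filter_upwards [ae_restrict_mem measurableSet_Ioi] with s hs
      have h1 : Tendsto (fun l : ℝ => s / l) (𝓝[>] 0) atTop := by
        simpa [div_eq_mul_inv] using tendsto_inv_nhdsGT_zero.const_mul_atTop hs
      have h2 := ((htail.comp h1).mul_const (s ^ (-α))).const_mul (K s)
      rw [show c * (K s * s ^ (-α)) = K s * (c * s ^ (-α)) by ring]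
      refine h2.congr' ?_
      filter_upwards [self_mem_nhdsWithin] with l hl
      rw [hid l hl s hs]
      rfl
  rw [integral_const_mul] at hlim
  refine hlim.congr' ?_
  filter_upwards [self_mem_nhdsWithin] with l hl
  have hl : 0 < l := hl
  have h := integral_comp_mul_left_Ioi (fun s => K s * p (s / l)) 0 hl
  simp only [mul_div_cancel_left₀ _ hl.ne', mul_zero, smul_eq_mul] at h
  have hpow : l ^ (1 - α) * l⁻¹ = l ^ (-α) := by
    rw [sub_eq_add_neg, Real.rpow_add hl, Real.rpow_one]
    field_simp
  rw [h, ← mul_assoc, hpow, ← integral_const_mul]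
  refine integral_congr_ae (ae_of_all _ fun s => ?_)
  simp only
  ring

/-- An Abelian theorem for a tail of order `t⁻¹`, with the exponential of the scale as
parameter. -/
lemma tendsto_log_integral_aux {q K : ℝ → ℝ} {c C : ℝ} (hqm : Measurable q)
    (hq0 : ∀ t, 0 < t → 0 ≤ q t) (hqC : ∀ t, 0 < t → q t * t ≤ C)
    (htail : Tendsto (fun t => q t * t) atTop (𝓝 c)) (hKm : Measurable K)
    (hK0 : ∀ s, 0 < s → 0 ≤ K s) (hK1 : ∀ s, 0 < s → K s ≤ 1) (hKs : ∀ s, 0 < s → K s * s ≤ 1)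
    (hKlim : Tendsto K (𝓝[>] 0) (𝓝 1)) :
    Tendsto (fun L : ℝ => (∫ t in Set.Ioi (1 : ℝ), K (Real.exp (-L) * t) * q t) / L) atTop
      (𝓝 c) := by
  -- Logarithmic scale t = exp(Lx): the kernel becomes a cutoff at x = 1, while q(t) t tends to c,
  -- so the limit is c times the length of (0, 1).
  have hlim : Tendsto (fun L : ℝ => ∫ x in Set.Ioi (0 : ℝ),
      K (Real.exp (L * (x - 1))) * (q (Real.exp (L * x)) * Real.exp (L * x))) atTop
      (𝓝 (∫ x in Set.Ioi (0 : ℝ), (Set.Iio 1).indicator (fun _ => c) x)) := by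
    refine tendsto_integral_filter_of_dominated_convergence
      (fun x => Real.exp 1 * C * Real.exp (-(1 * x))) ?_ ?_
      ((integrableOn_exp_neg_mul one_pos).const_mul _) ?_
    · exact Eventually.of_forall fun L => (by fun_prop : Measurable _).aestronglyMeasurable
    · filter_upwards [eventually_ge_atTop 1] with L hL
      refine ae_of_all _ fun x => ?_
      have he := Real.exp_pos (L * (x - 1))
      have he' := Real.exp_pos (L * x)
      have hqn : 0 ≤ q (Real.exp (L * x)) * Real.exp (L * x) := mul_nonneg (hq0 _ he') he'.le
      rw [Real.norm_eq_abs, abs_of_nonneg (mul_nonneg (hK0 _ he) hqn)]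
      -- Before the cutoff this is K ≤ 1; beyond it, K(s) ≤ 1/s together with L ≥ 1.
      have hKb : K (Real.exp (L * (x - 1))) ≤ Real.exp (1 - x) := by
        rcases le_total x 1 with hx | hx
        · exact (hK1 _ he).trans (Real.one_le_exp (by linarith))
        · have h1 : K (Real.exp (L * (x - 1))) ≤ Real.exp (-(L * (x - 1))) := by
            rw [Real.exp_neg, ← one_div, le_div_iff₀ he]
            exact hKs _ he
          refine h1.trans (Real.exp_le_exp.2 ?_)
          nlinarith
      calc _ ≤ Real.exp (1 - x) * C := mul_le_mul hKb (hqC _ he') hqn (Real.exp_pos _).le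
        _ = _ := by rw [sub_eq_add_neg, Real.exp_add, one_mul]; ring
    · have hne : ∀ᵐ x : ℝ ∂(volume.restrict (Set.Ioi 0)), x ≠ 1 :=
        ae_restrict_of_ae (by simp [ae_iff, measure_singleton])
      filter_upwards [hne, ae_restrict_mem measurableSet_Ioi] with x hx1 hx0
      have hx0 : 0 < x := hx0
      have hq : Tendsto (fun L : ℝ => q (Real.exp (L * x)) * Real.exp (L * x)) atTop (𝓝 c) :=
        htail.comp (Real.tendsto_exp_atTop.comp (tendsto_id.atTop_mul_const hx0))
      rcases lt_or_gt_of_ne hx1 with hx | hx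
      · rw [Set.indicator_of_mem (show x ∈ Set.Iio (1 : ℝ) from hx)]
        have h1 : Tendsto (fun L : ℝ => Real.exp (L * (x - 1))) atTop (𝓝[>] 0) :=
          Real.tendsto_exp_atBot_nhdsGT.comp
            (tendsto_id.atTop_mul_const_of_neg (by linarith))
        simpa using (hKlim.comp h1).mul hq
      · rw [Set.indicator_of_notMem (show x ∉ Set.Iio (1 : ℝ) from not_lt.2 hx.le)]
        have h1 : Tendsto (fun L : ℝ => Real.exp (-(L * (x - 1)))) atTop (𝓝 0) :=
          Real.tendsto_exp_neg_atTop_nhds_zero.comp (tendsto_id.atTop_mul_const (by linarith))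
        have h2 : Tendsto (fun L : ℝ => K (Real.exp (L * (x - 1)))) atTop (𝓝 0) := by
          refine squeeze_zero (fun L => hK0 _ (Real.exp_pos _)) (fun L => ?_) h1
          rw [Real.exp_neg, ← one_div, le_div_iff₀ (Real.exp_pos _)]
          exact hKs _ (Real.exp_pos _)
        simpa using h2.mul hq
  have hc : ∫ x in Set.Ioi (0 : ℝ), (Set.Iio 1).indicator (fun _ => c) x = c := by
    rw [setIntegral_indicator measurableSet_Iio, Set.Ioi_inter_Iio]
    simp
  rw [hc] at hlim
  refine hlim.congr' ?_
  filter_upwards [eventually_gt_atTop 0] with L hL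
  have himg : (fun x => Real.exp (L * x)) '' Set.Ioi 0 = Set.Ioi 1 := by
    ext y
    constructor
    · rintro ⟨x, hx, rfl⟩
      exact Real.one_lt_exp_iff.2 (mul_pos hL hx)
    · intro hy
      have hy : 1 < y := hy
      refine ⟨Real.log y / L, div_pos (Real.log_pos hy) hL, ?_⟩
      simp only
      rw [mul_div_cancel₀ _ hL.ne', Real.exp_log (by linarith)]
  have hsub := integral_image_eq_integral_abs_deriv_smul (s := Set.Ioi (0 : ℝ))
    (f := fun x => Real.exp (L * x)) (f' := fun x => Real.exp (L * x) * (L * 1)) measurableSet_Ioi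
    (fun x _ => (((hasDerivAt_id x).const_mul L).exp).hasDerivWithinAt)
    (fun x _ y _ hxy => mul_left_cancel₀ hL.ne' (Real.exp_injective hxy))
    fun t => K (Real.exp (-L) * t) * q t
  rw [himg] at hsub
  rw [hsub, eq_div_iff hL.ne', ← integral_mul_const]
  refine integral_congr_ae (ae_of_all _ fun x => ?_)
  simp only [smul_eq_mul, mul_one]
  rw [abs_of_pos (mul_pos (Real.exp_pos _) hL), ← Real.exp_add]
  ring_nf

lemma tendsto_log_one_div_nhdsGT_zero :
    Tendsto (fun l : ℝ => Real.log (1 / l)) (𝓝[>] 0) atTop := by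
  simpa only [one_div, Function.comp_def] using
    Real.tendsto_log_atTop.comp (tendsto_inv_nhdsGT_zero (𝕜 := ℝ))

/-- An Abelian theorem for a tail of order `t⁻¹`. -/
lemma tendsto_log_integral {q K : ℝ → ℝ} {c C : ℝ} (hqm : Measurable q)
    (hq0 : ∀ t, 0 < t → 0 ≤ q t) (hqC : ∀ t, 0 < t → q t * t ≤ C)
    (hq1 : ∀ t ∈ Set.Ioc (0 : ℝ) 1, q t ≤ 1)
    (htail : Tendsto (fun t => q t * t) atTop (𝓝 c)) (hKm : Measurable K)
    (hK0 : ∀ s, 0 < s → 0 ≤ K s) (hK1 : ∀ s, 0 < s → K s ≤ 1) (hKs : ∀ s, 0 < s → K s * s ≤ 1)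
    (hKlim : Tendsto K (𝓝[>] 0) (𝓝 1)) :
    Tendsto (fun l : ℝ => (∫ t in Set.Ioi (0 : ℝ), K (l * t) * q t) / Real.log (1 / l)) (𝓝[>] 0)
      (𝓝 c) := by
  have hL := tendsto_log_one_div_nhdsGT_zero
  have h1 := (tendsto_log_integral_aux hqm hq0 hqC htail hKm hK0 hK1 hKs hKlim).comp hL
  have hb : ∀ l > 0, ∀ t ∈ Set.Ioc (0 : ℝ) 1, ‖K (l * t) * q t‖ ≤ 1 := by
    intro l hl t ht
    have hlt : 0 < l * t := mul_pos hl ht.1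
    rw [Real.norm_eq_abs, abs_of_nonneg (mul_nonneg (hK0 _ hlt) (hq0 _ ht.1))]
    exact mul_le_one₀ (hK1 _ hlt) (hq0 _ ht.1) (hq1 t ht)
  -- The part over (0, 1] is bounded by 1, hence negligible against the logarithm.
  have h2 : Tendsto (fun l : ℝ => (∫ t in Set.Ioc (0 : ℝ) 1, K (l * t) * q t) /
      Real.log (1 / l)) (𝓝[>] 0) (𝓝 0) := by
    rw [tendsto_zero_iff_norm_tendsto_zero]
    refine squeeze_zero' (Eventually.of_forall fun _ => norm_nonneg _) ?_
      (tendsto_inv_atTop_zero.comp hL)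
    filter_upwards [self_mem_nhdsWithin, hL.eventually_gt_atTop 0] with l hl hlog
    rw [norm_div, Real.norm_of_nonneg hlog.le, div_eq_mul_inv]
    refine mul_le_of_le_one_left (inv_nonneg.2 hlog.le) ?_
    have := norm_setIntegral_le_of_norm_le_const (μ := volume) (s := Set.Ioc (0 : ℝ) 1) (by simp)
      (hb l hl)
    simpa using this
  have h3 := h2.add h1
  rw [zero_add] at h3
  refine h3.congr' ?_
  filter_upwards [self_mem_nhdsWithin] with l hl
  have hl : 0 < l := hl
  have hexp : Real.exp (-Real.log (1 / l)) = l := by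
    rw [one_div, Real.log_inv, neg_neg, Real.exp_log hl]
  simp only [Function.comp, hexp]
  rw [← add_div, ← Set.Ioc_union_Ioi_eq_Ioi (zero_le_one (α := ℝ)),
    setIntegral_union Set.Ioc_disjoint_Ioi_same measurableSet_Ioi]
  · refine Measure.integrableOn_of_bounded (M := 1) (by simp)
      (by fun_prop : Measurable _).aestronglyMeasurable ?_
    filter_upwards [ae_restrict_mem measurableSet_Ioc] with t ht
    exact hb l hl t ht
  · refine Integrable.mono' ((integrableOn_Ioi_rpow_of_lt (a := -2) (by norm_num)
      one_pos).const_mul (C / l)) (by fun_prop : Measurable _).aestronglyMeasurable ?_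
    filter_upwards [ae_restrict_mem measurableSet_Ioi] with t ht
    have ht0 : 0 < t := zero_lt_one.trans ht
    have hlt : 0 < l * t := mul_pos hl ht0
    rw [Real.norm_eq_abs, abs_of_nonneg (mul_nonneg (hK0 _ hlt) (hq0 _ ht0))]
    have e1 : K (l * t) ≤ 1 / (l * t) := by rw [le_div_iff₀ hlt]; exact hKs _ hlt
    have e2 : q t ≤ C / t := by rw [le_div_iff₀ ht0]; exact hqC _ ht0
    calc _ ≤ 1 / (l * t) * (C / t) := mul_le_mul e1 e2 (hq0 _ ht0) (by positivity)
      _ = _ := by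
        rw [Real.rpow_neg ht0.le, Real.rpow_two]
        field_simp

lemma one_sub_exp_neg_le (s : ℝ) : 1 - Real.exp (-s) ≤ s := by
  linarith [Real.add_one_le_exp (-s)]

lemma one_sub_exp_neg_nonneg {s : ℝ} (hs : 0 ≤ s) : 0 ≤ 1 - Real.exp (-s) := by
  have : Real.exp (-s) ≤ 1 := by rw [Real.exp_le_one_iff]; linarith
  linarith

lemma tendsto_one_sub_exp_neg_div : Tendsto (fun s : ℝ => (1 - Real.exp (-s)) / s) (𝓝[>] 0)
    (𝓝 1) := by
  have h1 : HasDerivAt (fun s : ℝ => 1 - Real.exp (-s)) 1 0 := by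
    have := ((hasDerivAt_neg (0 : ℝ)).exp).const_sub 1
    simpa using this
  have h2 := h1.tendsto_slope_zero_right
  refine h2.congr fun s => ?_
  simp [div_eq_inv_mul]

lemma integrableOn_one_sub_exp_mul_rpow {α : ℝ} (h1 : 1 < α) (h2 : α < 2) :
    IntegrableOn (fun s : ℝ => (1 - Real.exp (-s)) * s ^ (-α)) (Set.Ioi 0) := by
  have hm : Measurable fun s : ℝ => (1 - Real.exp (-s)) * s ^ (-α) := by fun_prop
  rw [← Set.Ioc_union_Ioi_eq_Ioi (zero_le_one (α := ℝ))]
  refine IntegrableOn.union ?_ ?_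
  · have h_int : IntegrableOn (fun s : ℝ => s ^ (1 - α)) (Set.Ioc 0 1) :=
      (intervalIntegrable_iff_integrableOn_Ioc_of_le zero_le_one).1
        (intervalIntegral.intervalIntegrable_rpow' (by linarith))
    refine Integrable.mono' h_int hm.aestronglyMeasurable ?_
    filter_upwards [ae_restrict_mem measurableSet_Ioc] with s hs
    have hr := Real.rpow_pos_of_pos hs.1 (-α)
    rw [Real.norm_eq_abs, abs_of_nonneg (mul_nonneg (one_sub_exp_neg_nonneg hs.1.le) hr.le),
      sub_eq_add_neg 1 α, Real.rpow_add hs.1, Real.rpow_one]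
    exact mul_le_mul_of_nonneg_right (one_sub_exp_neg_le s) hr.le
  · refine Integrable.mono' (integrableOn_Ioi_rpow_of_lt (a := -α) (by linarith) one_pos)
      hm.aestronglyMeasurable ?_
    filter_upwards [ae_restrict_mem measurableSet_Ioi] with s hs
    have hs0 : 0 < s := zero_lt_one.trans hs
    have hr := Real.rpow_pos_of_pos hs0 (-α)
    rw [Real.norm_eq_abs, abs_of_nonneg (mul_nonneg (one_sub_exp_neg_nonneg hs0.le) hr.le)]
    exact mul_le_of_le_one_left hr.le (by linarith [Real.exp_pos (-s)])

/-- Integration by parts against s^(1-α)/(1-α). The boundary term vanishes at 0 because 1 - exp(-s)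
is of order s and α < 2, and at infinity because α > 1. -/
lemma integral_one_sub_exp_mul_rpow {α : ℝ} (h1 : 1 < α) (h2 : α < 2) :
    ∫ s in Set.Ioi (0 : ℝ), (1 - Real.exp (-s)) * s ^ (-α) = Real.Gamma (2 - α) / (α - 1) := by
  have hα : (1 - α) ≠ 0 := by linarith
  have hΓ : IntegrableOn (fun s : ℝ => Real.exp (-s) * s ^ (1 - α)) (Set.Ioi 0) := by
    have := Real.GammaIntegral_convergent (s := 2 - α) (by linarith)
    convert this using 3
    ring_nf
  have hlim0 : Tendsto (fun s : ℝ => (1 - Real.exp (-s)) * (s ^ (1 - α) / (1 - α))) (𝓝[>] 0)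
      (𝓝 0) := by
    have e1 : Tendsto (fun s : ℝ => s ^ (2 - α)) (𝓝[>] 0) (𝓝 0) := by
      have := (Real.continuousAt_rpow_const 0 (2 - α) (Or.inr (by linarith))).tendsto
      rw [Real.zero_rpow (by linarith)] at this
      exact this.mono_left nhdsWithin_le_nhds
    have e2 := (tendsto_one_sub_exp_neg_div.mul e1).div_const (1 - α)
    rw [mul_zero, zero_div] at e2
    refine e2.congr' ?_
    filter_upwards [self_mem_nhdsWithin] with s hs
    have hs : 0 < s := hs
    rw [show 2 - α = 1 + (1 - α) by ring, Real.rpow_add hs, Real.rpow_one]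
    field_simp
  have hliminf : Tendsto (fun s : ℝ => (1 - Real.exp (-s)) * (s ^ (1 - α) / (1 - α))) atTop
      (𝓝 0) := by
    have e1 : Tendsto (fun s : ℝ => s ^ (1 - α)) atTop (𝓝 0) := by
      have := tendsto_rpow_neg_atTop (y := α - 1) (by linarith)
      simpa using this
    have e2 : Tendsto (fun s : ℝ => 1 - Real.exp (-s)) atTop (𝓝 (1 - 0)) :=
      tendsto_const_nhds.sub Real.tendsto_exp_neg_atTop_nhds_zero
    simpa using e2.mul (e1.div_const (1 - α))
  have hu : ∀ s ∈ Set.Ioi (0 : ℝ), HasDerivAt (fun s : ℝ => 1 - Real.exp (-s)) (Real.exp (-s)) s :=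
    fun s _ => by simpa using ((hasDerivAt_neg s).exp).const_sub 1
  have hv : ∀ s ∈ Set.Ioi (0 : ℝ), HasDerivAt (fun s : ℝ => s ^ (1 - α) / (1 - α)) (s ^ (-α)) s :=
    fun s hs => by
      have := (Real.hasDerivAt_rpow_const (x := s) (p := 1 - α) (Or.inl (ne_of_gt hs))).div_const
        (1 - α)
      rwa [mul_div_cancel_left₀ _ hα, show 1 - α - 1 = -α by ring] at this
  have hparts := integral_Ioi_mul_deriv_eq_deriv_mul hu hv
    (integrableOn_one_sub_exp_mul_rpow h1 h2)
    ((hΓ.div_const (1 - α)).congr (ae_of_all _ fun s => by simp [mul_div_assoc])) hlim0 hliminf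
  rw [hparts, Real.Gamma_eq_integral (by linarith)]
  simp only [← mul_div_assoc]
  rw [integral_div, show (2 - α - 1) = 1 - α by ring, sub_zero, zero_sub, ← div_neg, neg_sub]

/-! ### The transform of p near zero under a polynomial tail -/

namespace IsReturnProfile

variable {p : ℝ → ℝ} (hp : IsReturnProfile p) {α c : ℝ} (hα : 0 < α)
  (htail : Tendsto (fun t => p t * t ^ α) atTop (𝓝 c))

include hp htail

include hα in
lemma exists_mul_rpow_le : ∃ C, ∀ t, 0 < t → p t * t ^ α ≤ C := by
  obtain ⟨T, hT⟩ := eventually_atTop.1 (htail.eventually (gt_mem_nhds (lt_add_one c)))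
  refine ⟨max (c + 1) (|T| ^ α), fun t ht => ?_⟩
  rcases le_total T t with h | h
  · exact (hT t h).le.trans (le_max_left _ _)
  · refine le_trans ?_ (le_max_right _ _)
    calc p t * t ^ α ≤ 1 * t ^ α :=
          mul_le_mul_of_nonneg_right (hp.le_one t) (Real.rpow_nonneg ht.le _)
      _ ≤ |T| ^ α := by
          rw [one_mul]
          exact Real.rpow_le_rpow ht.le (h.trans (le_abs_self T)) hα.le

include hα in
lemma exists_le_mul_rpow : ∃ C, ∀ t, 0 < t → p t ≤ C * t ^ (-α) := by
  obtain ⟨C, hC⟩ := hp.exists_mul_rpow_le hα htail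
  refine ⟨C, fun t ht => ?_⟩
  rw [Real.rpow_neg ht.le, ← div_eq_mul_inv, le_div_iff₀ (Real.rpow_pos_of_pos ht α)]
  exact hC t ht

lemma mass_ne_top (h1 : 1 < α) : mass p ≠ ⊤ := by
  obtain ⟨C, hC⟩ := hp.exists_le_mul_rpow (by linarith) htail
  have h_int : IntegrableOn p (Set.Ioi 0) :=
    integrableOn_Ioi_zero_of_bounded_of_rpow hp.measurable (A := 1) (B := C) h1
      (fun t _ => by rw [abs_of_nonneg (hp.nonneg t)]; exact hp.le_one t)
      (fun t ht => by
        rw [abs_of_nonneg (hp.nonneg t)]; exact hC t (zero_lt_one.trans ht))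
  have := (hasFiniteIntegral_iff_ofReal (ae_of_all _ hp.nonneg)).1 h_int.2
  exact this.ne

include hα in
lemma tendsto_rpow_mul_laplace (h1 : α < 1) :
    Tendsto (fun l => l ^ (1 - α) * laplace p l) (𝓝[>] 0) (𝓝 (c * Real.Gamma (1 - α))) := by
  obtain ⟨C, hC⟩ := hp.exists_mul_rpow_le hα htail
  have hΓ := Real.GammaIntegral_convergent (s := 1 - α) (by linarith)
  rw [show 1 - α - 1 = -α by ring] at hΓ
  have h := tendsto_scaled_integral hp.measurable hp.nonneg hC htail (K := fun s => Real.exp (-s))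
    (by fun_prop) (fun s _ => (Real.exp_pos _).le) hΓ
  rwa [Real.Gamma_eq_integral (by linarith), show 1 - α - 1 = -α by ring]

lemma tendsto_laplace_div_log (h1 : α = 1) :
    Tendsto (fun l => laplace p l / Real.log (1 / l)) (𝓝[>] 0) (𝓝 c) := by
  subst h1
  obtain ⟨C, hC⟩ := hp.exists_mul_rpow_le one_pos htail
  simp only [Real.rpow_one] at hC htail
  refine tendsto_log_integral hp.measurable (fun t _ => hp.nonneg t) hC (fun t _ => hp.le_one t)
    htail (K := fun s => Real.exp (-s)) (by fun_prop) (fun s _ => (Real.exp_pos _).le)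
    (fun s hs => by rw [Real.exp_le_one_iff]; linarith) (fun s hs => ?_) ?_
  · rw [Real.exp_neg, inv_mul_le_one₀ (Real.exp_pos s)]
    linarith [Real.add_one_le_exp s]
  · have : Tendsto (fun s : ℝ => Real.exp (-s)) (𝓝 0) (𝓝 (Real.exp (-0))) :=
      (by fun_prop : Continuous fun s : ℝ => Real.exp (-s)).tendsto 0
    rw [neg_zero, Real.exp_zero] at this
    exact this.mono_left nhdsWithin_le_nhds

lemma tendsto_mass_sub_laplace_div_rpow (h1 : 1 < α) (h2 : α < 2) :
    Tendsto (fun l => ((mass p).toReal - laplace p l) / l ^ (α - 1)) (𝓝[>] 0)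
      (𝓝 (c * (Real.Gamma (2 - α) / (α - 1)))) := by
  obtain ⟨C, hC⟩ := hp.exists_mul_rpow_le (by linarith) htail
  have h := tendsto_scaled_integral hp.measurable hp.nonneg hC htail
    (K := fun s => 1 - Real.exp (-s)) (by fun_prop) (fun s hs => one_sub_exp_neg_nonneg hs.le)
    (integrableOn_one_sub_exp_mul_rpow h1 h2)
  rw [integral_one_sub_exp_mul_rpow h1 h2] at h
  refine h.congr' ?_
  filter_upwards [self_mem_nhdsWithin] with l hl
  rw [hp.mass_sub_laplace (hp.mass_ne_top htail h1) hl, div_eq_mul_inv,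
    ← Real.rpow_neg (le_of_lt hl), neg_sub, mul_comm]

omit htail in
-- Moving one factor t into the weight leaves the kernel (1 - exp(-s))/s, which is at most 1 and at
-- most 1/s. For α = 2 the weight t p(t) has a tail of order 1/t, and for α > 2 it is integrable.
lemma mass_sub_laplace_eq_mul (h : mass p ≠ ⊤) {l : ℝ} (hl : 0 < l) :
    (mass p).toReal - laplace p l =
      l * ∫ t in Set.Ioi (0 : ℝ), (1 - Real.exp (-(l * t))) / (l * t) * (t * p t) := by
  rw [hp.mass_sub_laplace h hl, ← integral_const_mul]
  refine setIntegral_congr_fun measurableSet_Ioi fun t ht => ?_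
  have ht : 0 < t := ht
  field_simp

lemma tendsto_mass_sub_laplace_div_log (h2 : α = 2) :
    Tendsto (fun l => ((mass p).toReal - laplace p l) / (l * Real.log (1 / l))) (𝓝[>] 0)
      (𝓝 c) := by
  subst h2
  obtain ⟨C, hC⟩ := hp.exists_mul_rpow_le two_pos htail
  have hfin := hp.mass_ne_top htail one_lt_two
  have hpm := hp.measurable
  simp only [Real.rpow_two] at hC htail
  have h := tendsto_log_integral (q := fun t => t * p t) (c := c) (C := C) (by fun_prop)
    (fun t ht => mul_nonneg ht.le (hp.nonneg t))
    (fun t ht => le_trans (le_of_eq (by ring)) (hC t ht))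
    (fun t ht => mul_le_one₀ ht.2 (hp.nonneg t) (hp.le_one t))
    (htail.congr fun t => by ring)
    (K := fun s => (1 - Real.exp (-s)) / s) (by fun_prop)
    (fun s hs => div_nonneg (one_sub_exp_neg_nonneg hs.le) hs.le)
    (fun s hs => (div_le_one hs).2 (one_sub_exp_neg_le s))
    (fun s hs => by
      rw [div_mul_cancel₀ _ hs.ne']
      linarith [Real.exp_pos (-s)])
    tendsto_one_sub_exp_neg_div
  refine h.congr' ?_
  filter_upwards [self_mem_nhdsWithin] with l hl
  rw [hp.mass_sub_laplace_eq_mul hfin hl, mul_div_mul_left _ _ (ne_of_gt hl)]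

lemma integrableOn_mul_self (h2 : 2 < α) : IntegrableOn (fun t => t * p t) (Set.Ioi 0) := by
  obtain ⟨C, hC⟩ := hp.exists_le_mul_rpow (by linarith) htail
  refine integrableOn_Ioi_zero_of_bounded_of_rpow (measurable_id.mul hp.measurable) (A := 1)
    (B := C) (β := α - 1) (by linarith) (fun t ht => ?_) (fun t ht => ?_)
  · rw [abs_of_nonneg (mul_nonneg ht.1.le (hp.nonneg t))]
    exact mul_le_one₀ ht.2 (hp.nonneg t) (hp.le_one t)
  · have ht0 : 0 < t := zero_lt_one.trans ht
    rw [abs_of_nonneg (mul_nonneg ht0.le (hp.nonneg t))]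
    calc t * p t ≤ t * (C * t ^ (-α)) := mul_le_mul_of_nonneg_left (hC t ht0) ht0.le
      _ = _ := by
        rw [show -(α - 1) = 1 + -α by ring, Real.rpow_add ht0, Real.rpow_one]
        ring

lemma tendsto_mass_sub_laplace_div (h2 : 2 < α) :
    Tendsto (fun l => ((mass p).toReal - laplace p l) / l) (𝓝[>] 0)
      (𝓝 (∫ t in Set.Ioi (0 : ℝ), t * p t)) := by
  have hfin := hp.mass_ne_top htail (by linarith)
  have h_int := hp.integrableOn_mul_self htail h2
  have hpm := hp.measurable
  have hlim : Tendsto (fun l : ℝ => ∫ t in Set.Ioi (0 : ℝ),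
      (1 - Real.exp (-(l * t))) / (l * t) * (t * p t)) (𝓝[>] 0)
      (𝓝 (∫ t in Set.Ioi (0 : ℝ), t * p t)) := by
    refine tendsto_integral_filter_of_dominated_convergence (fun t => t * p t) ?_ ?_ h_int ?_
    · exact Eventually.of_forall fun l => (by fun_prop : Measurable _).aestronglyMeasurable
    · filter_upwards [self_mem_nhdsWithin] with l hl
      filter_upwards [ae_restrict_mem measurableSet_Ioi] with t ht
      have hlt : 0 < l * t := mul_pos hl ht
      have h0 := mul_nonneg (le_of_lt ht) (hp.nonneg t)
      rw [Real.norm_eq_abs, abs_of_nonneg (mul_nonneg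
        (div_nonneg (one_sub_exp_neg_nonneg hlt.le) hlt.le) h0)]
      exact mul_le_of_le_one_left h0 ((div_le_one hlt).2 (one_sub_exp_neg_le _))
    · filter_upwards [ae_restrict_mem measurableSet_Ioi] with t ht
      have ht : 0 < t := ht
      have h1 : Tendsto (fun l : ℝ => l * t) (𝓝[>] 0) (𝓝[>] 0) := by
        refine tendsto_nhdsWithin_iff.2 ⟨?_, ?_⟩
        · have : Tendsto (fun l : ℝ => l * t) (𝓝 0) (𝓝 (0 * t)) :=
            (continuous_mul_const t).tendsto 0
          rw [zero_mul] at this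
          exact this.mono_left nhdsWithin_le_nhds
        · filter_upwards [self_mem_nhdsWithin] with l hl
          exact mul_pos hl ht
      simpa using (tendsto_one_sub_exp_neg_div.comp h1).mul_const (t * p t)
  refine hlim.congr' ?_
  filter_upwards [self_mem_nhdsWithin] with l hl
  rw [hp.mass_sub_laplace_eq_mul hfin hl, mul_div_cancel_left₀ _ (ne_of_gt hl)]

include hα in
-- A finite mass would bound p̂ near 0, contradicting its Abelian blow-up there.
lemma mass_eq_top (hc : 0 < c) (h1 : α ≤ 1) : mass p = ⊤ := by
  by_contra hfin
  have hbound : ∀ᶠ l in 𝓝[>] (0 : ℝ), laplace p l ≤ (mass p).toReal := by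
    filter_upwards [self_mem_nhdsWithin] with l hl
    exact (hp.laplace_lt_mass hfin hl).le
  have hnn : ∀ᶠ l in 𝓝[>] (0 : ℝ), 0 ≤ laplace p l := by
    filter_upwards [self_mem_nhdsWithin] with l hl
    exact (hp.laplace_pos hl).le
  rcases h1.lt_or_eq with h | h
  · have hlim := hp.tendsto_rpow_mul_laplace hα htail h
    have h0 : Tendsto (fun l : ℝ => l ^ (1 - α) * laplace p l) (𝓝[>] 0) (𝓝 0) := by
      have e1 : Tendsto (fun s : ℝ => s ^ (1 - α)) (𝓝[>] 0) (𝓝 0) := by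
        have := (Real.continuousAt_rpow_const 0 (1 - α) (Or.inr (by linarith))).tendsto
        rw [Real.zero_rpow (by linarith)] at this
        exact this.mono_left nhdsWithin_le_nhds
      have e2 := e1.mul_const (mass p).toReal
      rw [zero_mul] at e2
      refine squeeze_zero' ?_ ?_ e2
      · filter_upwards [hnn, self_mem_nhdsWithin] with l h1 h2
        exact mul_nonneg (Real.rpow_nonneg (le_of_lt h2) _) h1
      · filter_upwards [hbound, self_mem_nhdsWithin] with l h1 h2
        exact mul_le_mul_of_nonneg_left h1 (Real.rpow_nonneg (le_of_lt h2) _)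
    have := tendsto_nhds_unique hlim h0
    have hΓ : 0 < Real.Gamma (1 - α) := Real.Gamma_pos_of_pos (by linarith)
    exact (mul_pos hc hΓ).ne' this
  · have hlim := hp.tendsto_laplace_div_log htail h
    have hL := tendsto_log_one_div_nhdsGT_zero
    have h0 : Tendsto (fun l : ℝ => laplace p l / Real.log (1 / l)) (𝓝[>] 0) (𝓝 0) := by
      refine squeeze_zero' ?_ ?_ ((tendsto_const_nhds (x := (mass p).toReal)).div_atTop hL)
      · filter_upwards [hnn, hL.eventually_gt_atTop 0] with l h1 h2
        exact div_nonneg h1 h2.le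
      · filter_upwards [hbound, hL.eventually_gt_atTop 0] with l h1 h2
        exact div_le_div_of_nonneg_right h1 h2.le
    exact hc.ne' (tendsto_nhds_unique hlim h0)

end IsReturnProfile

/-! ### Inversion: the rate near the critical value -/

lemma isEquivalent_of_tendsto_rpow_div {F : Filter ℝ} {f δ : ℝ → ℝ} {γ A : ℝ} (hγ : 0 < γ)
    (hA : 0 < A) (hf : ∀ᶠ x in F, 0 < f x) (hδ : ∀ᶠ x in F, 0 < δ x)
    (h : Tendsto (fun x => f x ^ γ / δ x) F (𝓝 A)) :
    f ~[F] fun x => δ x ^ (1 / γ) * A ^ (1 / γ) := by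
  have hAγ : 0 < A ^ (1 / γ) := Real.rpow_pos_of_pos hA _
  refine isEquivalent_of_tendsto_one ?_
  have h1 : Tendsto (fun x => (f x ^ γ / δ x) ^ (1 / γ)) F (𝓝 (A ^ (1 / γ))) :=
    ((Real.continuousAt_rpow_const A (1 / γ) (Or.inl hA.ne')).tendsto).comp h
  have h2 := h1.div_const (A ^ (1 / γ))
  rw [div_self hAγ.ne'] at h2
  refine h2.congr' ?_
  filter_upwards [hf, hδ] with x hx hy
  rw [Real.div_rpow (Real.rpow_nonneg hx.le _) hy.le, ← Real.rpow_mul hx.le,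
    mul_one_div_cancel hγ.ne', Real.rpow_one, div_div]
  rfl

namespace IsReturnProfile

variable {p : ℝ → ℝ} (hp : IsReturnProfile p)

include hp

lemma eventually_rate_pos : ∀ᶠ κ in 𝓝[>] ((mass p)⁻¹).toReal, 0 < rate p κ := by
  filter_upwards [self_mem_nhdsWithin] with κ hκ
  exact (hp.rate_spec (ENNReal.toReal_nonneg.trans_lt hκ) hκ).1

lemma eventually_laplace_rate :
    ∀ᶠ κ in 𝓝[>] ((mass p)⁻¹).toReal, laplace p (rate p κ) = κ⁻¹ := by
  filter_upwards [self_mem_nhdsWithin] with κ hκ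
  exact eq_inv_of_mul_eq_one_right (hp.rate_spec (ENNReal.toReal_nonneg.trans_lt hκ) hκ).2

/-- Inversion near a positive critical value. -/
lemma tendsto_comp_rate_div (hfin : mass p ≠ ⊤) {g : ℝ → ℝ} {B : ℝ} (hB : B ≠ 0)
    (h : Tendsto (fun l => ((mass p).toReal - laplace p l) / g l) (𝓝[>] 0) (𝓝 B)) :
    Tendsto (fun κ => g (rate p κ) / (κ - ((mass p)⁻¹).toReal)) (𝓝[>] ((mass p)⁻¹).toReal)
      (𝓝 ((mass p).toReal ^ 2 / B)) := by
  have hG : 0 < (mass p).toReal := ENNReal.toReal_pos hp.mass_pos.ne' hfin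
  have hcr : ((mass p)⁻¹).toReal = (mass p).toReal⁻¹ := ENNReal.toReal_inv _
  have h1 := (h.comp hp.tendsto_rate_critical).inv₀ hB
  -- With p̂(r) = 1/κ one has G - p̂(r) = (κ - 1/G) G/κ, and G/κ tends to G² as κ tends to 1/G.
  have h2 : Tendsto (fun κ : ℝ => (mass p).toReal * κ⁻¹) (𝓝[>] ((mass p)⁻¹).toReal)
      (𝓝 ((mass p).toReal * (mass p).toReal)) := by
    refine Tendsto.const_mul _ ?_
    have : Tendsto (fun κ : ℝ => κ⁻¹) (𝓝 ((mass p).toReal⁻¹)) (𝓝 ((mass p).toReal⁻¹⁻¹)) :=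
      tendsto_inv₀ (inv_pos.2 hG).ne'
    rw [inv_inv] at this
    rw [hcr]
    exact this.mono_left nhdsWithin_le_nhds
  have h3 := h2.mul h1
  rw [show (mass p).toReal ^ 2 / B = (mass p).toReal * (mass p).toReal * B⁻¹ by
    rw [div_eq_mul_inv, sq]]
  refine h3.congr' ?_
  filter_upwards [hp.eventually_laplace_rate, self_mem_nhdsWithin] with κ hκ hlt
  have hκ0 : 0 < κ := ENNReal.toReal_nonneg.trans_lt hlt
  simp only [Function.comp, hκ, hcr]
  rw [inv_div]
  have hne : (mass p).toReal * κ - 1 ≠ 0 := by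
    have : (mass p).toReal⁻¹ < κ := hcr ▸ hlt
    rw [inv_lt_iff_one_lt_mul₀ hG] at this
    linarith
  have e1 : (mass p).toReal - κ⁻¹ = ((mass p).toReal * κ - 1) / κ := by field_simp
  have e2 : κ - (mass p).toReal⁻¹ = ((mass p).toReal * κ - 1) / (mass p).toReal := by field_simp
  rw [e1, e2]
  field_simp

variable {α c : ℝ} (hc : 0 < c) (htail : Tendsto (fun t => p t * t ^ α) atTop (𝓝 c))

include hc htail

lemma rate_isEquivalent_of_lt_one (hα : 0 < α) (h1 : α < 1) :
    rate p ~[𝓝[>] 0] fun κ : ℝ =>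
      κ ^ (1 / (1 - α)) * (c * Real.Gamma (1 - α)) ^ (1 / (1 - α)) := by
  have hcr : ((mass p)⁻¹).toReal = 0 := by simp [hp.mass_eq_top hα htail hc h1.le]
  have hpos := hp.eventually_rate_pos
  have heq := hp.eventually_laplace_rate
  have hlim := (hp.tendsto_rpow_mul_laplace hα htail h1).comp hp.tendsto_rate_critical
  rw [hcr] at hpos heq hlim
  have hΓ : 0 < Real.Gamma (1 - α) := Real.Gamma_pos_of_pos (by linarith)
  refine isEquivalent_of_tendsto_rpow_div (by linarith) (mul_pos hc hΓ) hpos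
    self_mem_nhdsWithin (hlim.congr' ?_)
  filter_upwards [heq] with κ hκ
  simp only [Function.comp, hκ, div_eq_mul_inv]

lemma rate_isEquivalent_of_eq_one (h1 : α = 1) :
    ∃ ε : ℝ → ℝ, ε =o[𝓝[>] 0] (fun κ : ℝ => κ⁻¹) ∧
      rate p ~[𝓝[>] 0] fun κ : ℝ => Real.exp (-(c * κ)⁻¹ + ε κ) := by
  have hcr : ((mass p)⁻¹).toReal = 0 := by simp [hp.mass_eq_top (by linarith) htail hc h1.le]
  have hpos := hp.eventually_rate_pos
  have heq := hp.eventually_laplace_rate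
  have hlim := (hp.tendsto_laplace_div_log htail h1).comp hp.tendsto_rate_critical
  rw [hcr] at hpos heq hlim
  -- This error term makes the exponential exactly equal to the rate; only its size remains to be
  -- estimated.
  refine ⟨fun κ => Real.log (rate p κ) + (c * κ)⁻¹, ?_, ?_⟩
  · refine isLittleO_of_tendsto' ?_ ?_
    · filter_upwards [self_mem_nhdsWithin] with κ hκ h
      exact absurd h (inv_pos.2 hκ).ne'
    · have h2 := (hlim.inv₀ hc.ne').const_sub c⁻¹
      rw [sub_self] at h2
      refine h2.congr' ?_
      filter_upwards [self_mem_nhdsWithin, heq] with κ hκ hl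
      have hκ : 0 < κ := hκ
      simp only [Function.comp, hl]
      rw [one_div, Real.log_inv]
      simp only [mul_inv, inv_div, div_inv_eq_mul]
      field_simp
      ring
  · refine IsEquivalent.refl.congr_right ?_
    filter_upwards [hpos] with κ hκ
    simp [Real.exp_log hκ]

lemma rate_isEquivalent_of_lt_two (h1 : 1 < α) (h2 : α < 2) :
    rate p ~[𝓝[>] ((mass p)⁻¹).toReal] fun κ : ℝ =>
      (κ - ((mass p)⁻¹).toReal) ^ (1 / (α - 1)) *
        ((mass p).toReal ^ 2 * (α - 1) / (c * Real.Gamma (2 - α))) ^ (1 / (α - 1)) := by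
  have hfin := hp.mass_ne_top htail h1
  have hG : 0 < (mass p).toReal := ENNReal.toReal_pos hp.mass_pos.ne' hfin
  have hΓ : 0 < Real.Gamma (2 - α) := Real.Gamma_pos_of_pos (by linarith)
  have hα1 : 0 < α - 1 := by linarith
  have h := hp.tendsto_comp_rate_div hfin (mul_pos hc (div_pos hΓ hα1)).ne'
    (hp.tendsto_mass_sub_laplace_div_rpow htail h1 h2)
  rw [show (mass p).toReal ^ 2 / (c * (Real.Gamma (2 - α) / (α - 1))) =
    (mass p).toReal ^ 2 * (α - 1) / (c * Real.Gamma (2 - α)) by field_simp] at h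
  refine isEquivalent_of_tendsto_rpow_div hα1 (by positivity) hp.eventually_rate_pos ?_ h
  filter_upwards [self_mem_nhdsWithin] with κ hκ
  exact sub_pos.2 hκ

lemma rate_isEquivalent_of_eq_two (h2 : α = 2) :
    rate p ~[𝓝[>] ((mass p)⁻¹).toReal] fun κ : ℝ =>
      (κ - ((mass p)⁻¹).toReal) / Real.log (1 / (κ - ((mass p)⁻¹).toReal)) *
        ((mass p).toReal ^ 2 / c) := by
  have hfin := hp.mass_ne_top htail (by linarith)
  have hG : 0 < (mass p).toReal := ENNReal.toReal_pos hp.mass_pos.ne' hfin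
  set k := ((mass p)⁻¹).toReal with hk
  set D := (mass p).toReal ^ 2 / c with hD
  have hD0 : 0 < D := by positivity
  have h := hp.tendsto_comp_rate_div hfin hc.ne' (hp.tendsto_mass_sub_laplace_div_log htail h2)
  have hL := tendsto_log_one_div_nhdsGT_zero.comp hp.tendsto_rate_critical
  -- To solve r log(1/r) ~ D(κ - k) for r, take logarithms and divide by log(1/r): the iterated
  -- logarithm drops out, so log(1/r) may be replaced by log(1/(κ - k)).
  have hlogratio : Tendsto (fun κ => Real.log (1 / (κ - k)) / Real.log (1 / rate p κ)) (𝓝[>] k)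
      (𝓝 1) := by
    have e1 := ((Real.continuousAt_log hD0.ne').tendsto.comp h).div_atTop hL
    have e2 : Tendsto (fun κ => Real.log (Real.log (1 / rate p κ)) / Real.log (1 / rate p κ))
        (𝓝[>] k) (𝓝 0) := by
      have := (Real.isLittleO_log_id_atTop.tendsto_div_nhds_zero).comp hL
      exact this
    have e3 := (e1.sub e2).add_const 1
    rw [sub_zero, zero_add] at e3
    refine e3.congr' ?_
    filter_upwards [hp.eventually_rate_pos, self_mem_nhdsWithin, hL.eventually_gt_atTop 0]
      with κ hr hκ hl
    have hδ : 0 < κ - k := sub_pos.2 hκ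
    simp only [Function.comp] at hl ⊢
    rw [Real.log_div (mul_pos hr hl).ne' hδ.ne', Real.log_mul hr.ne' hl.ne', ← sub_div,
      div_add_one hl.ne']
    congr 1
    rw [one_div (κ - k), Real.log_inv (κ - k)]
    have : Real.log (1 / rate p κ) = -Real.log (rate p κ) := by rw [one_div, Real.log_inv]
    linarith
  refine isEquivalent_of_tendsto_one ?_
  have h3 := (h.mul hlogratio).div_const D
  rw [mul_one, div_self hD0.ne'] at h3
  refine h3.congr' ?_
  filter_upwards [hp.eventually_rate_pos, self_mem_nhdsWithin, hL.eventually_gt_atTop 0]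
    with κ hr hκ hl
  have hδ : κ - k ≠ 0 := (sub_pos.2 hκ).ne'
  simp only [Function.comp, Pi.div_apply] at hl ⊢
  rw [← hk, div_mul_eq_mul_div (κ - k), div_div_eq_mul_div]
  rw [hD]
  field_simp

omit hc in
lemma rate_isEquivalent_of_two_lt (h2 : 2 < α) :
    rate p ~[𝓝[>] ((mass p)⁻¹).toReal] fun κ : ℝ =>
      (κ - ((mass p)⁻¹).toReal) *
        ((mass p).toReal ^ 2 / ∫ t in Set.Ioi (0 : ℝ), t * p t) := by
  have hfin := hp.mass_ne_top htail (by linarith)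
  have hG : 0 < (mass p).toReal := ENNReal.toReal_pos hp.mass_pos.ne' hfin
  have hH : 0 < ∫ t in Set.Ioi (0 : ℝ), t * p t :=
    hp.setIntegral_mul_pos (fun t ht => ht) (hp.integrableOn_mul_self htail h2)
  have h := hp.tendsto_comp_rate_div hfin hH.ne' (hp.tendsto_mass_sub_laplace_div htail h2)
  have h' : Tendsto (fun κ => rate p κ ^ (1 : ℝ) / (κ - ((mass p)⁻¹).toReal))
      (𝓝[>] ((mass p)⁻¹).toReal)
      (𝓝 ((mass p).toReal ^ 2 / ∫ t in Set.Ioi (0 : ℝ), t * p t)) := by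
    simpa using h
  have h3 := isEquivalent_of_tendsto_rpow_div one_pos (by positivity) hp.eventually_rate_pos
    (by filter_upwards [self_mem_nhdsWithin] with κ hκ using sub_pos.2 hκ) h'
  simpa using h3

end IsReturnProfile

/-! ### Strict convexity of the rate -/

namespace IsReturnProfile

variable {p : ℝ → ℝ} (hp : IsReturnProfile p)

include hp

lemma integrableOn_pow_mul_laplace {l : ℝ} (hl : 0 < l) (n : ℕ) :
    IntegrableOn (fun t => t ^ n * Real.exp (-(l * t)) * p t) (Set.Ioi 0) := by
  have hpm := hp.measurable
  have h_int : IntegrableOn (fun t : ℝ => t ^ n * Real.exp (-(l * t))) (Set.Ioi 0) := by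
    have := integrableOn_rpow_mul_exp_neg_mul_rpow (s := n) (p := 1) (b := l)
      (by have : (0 : ℝ) ≤ n := n.cast_nonneg
          linarith) one_pos hl
    simpa using this
  refine Integrable.mono' h_int (by fun_prop : Measurable _).aestronglyMeasurable ?_
  filter_upwards [ae_restrict_mem measurableSet_Ioi] with t ht
  have h0 : 0 ≤ t ^ n * Real.exp (-(l * t)) :=
    mul_nonneg (pow_nonneg (le_of_lt ht) n) (Real.exp_pos _).le
  rw [Real.norm_eq_abs, abs_of_nonneg (mul_nonneg h0 (hp.nonneg t))]
  exact mul_le_of_le_one_right h0 (hp.le_one t)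

/-- Differentiate p̂(l) = s/(l+b) n times. These moments replace an appeal to uniqueness of Laplace
transforms. -/
lemma laplace_moment_eq {b s : ℝ} (hb : ∀ l, 0 < l → 0 < l + b)
    (h : ∀ l, 0 < l → laplace p l * (l + b) = s) (n : ℕ) :
    ∀ l, 0 < l → ∫ t in Set.Ioi (0 : ℝ), t ^ n * Real.exp (-(l * t)) * p t =
      n.factorial * s / (l + b) ^ (n + 1) := by
  induction n with
  | zero =>
    intro l hl
    have := h l hl
    rw [laplace] at this
    simp only [pow_zero, one_mul, Nat.factorial_zero, Nat.cast_one, zero_add, pow_one]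
    rw [← this, mul_div_cancel_right₀ _ (hb l hl).ne']
  | succ n ih =>
    intro l hl
    have h1 := hp.hasDerivAt_laplace_moment hl n
    have h2 : HasDerivAt (fun l : ℝ => n.factorial * s / (l + b) ^ (n + 1))
        ((0 * (l + b) ^ (n + 1) - n.factorial * s * (((n + 1 : ℕ) : ℝ) * (l + b) ^ (n + 1 - 1) * 1))
          / ((l + b) ^ (n + 1)) ^ 2) l :=
      (hasDerivAt_const l _).div (((hasDerivAt_id l).add_const b).pow (n + 1))
        (pow_pos (hb l hl) _).ne'
    have h3 := h2.congr_of_eventuallyEq (f₁ := fun l =>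
      ∫ t in Set.Ioi (0 : ℝ), t ^ n * Real.exp (-(l * t)) * p t)
      (by filter_upwards [Ioi_mem_nhds hl] with m hm using ih m hm)
    have h4 := h1.unique h3
    have hne := (hb l hl).ne'
    rw [neg_eq_iff_eq_neg] at h4
    rw [h4, Nat.factorial_succ, Nat.add_sub_cancel]
    push_cast
    field_simp
    ring

/-- If b = 0, then l p̂(l) = s > 0, yet l p̂(l) tends to 0 with p. If b > 0, the tilted n-th moments
stay bounded as l ↓ 0, whereas for n ≥ α the tail makes them at least of order 1/l. -/
lemma laplace_ne_rational {α c : ℝ} (hα : 0 < α) (hc : 0 < c)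
    (htail : Tendsto (fun t => p t * t ^ α) atTop (𝓝 c)) {b s : ℝ} (hs : 0 < s)
    (h : ∀ l, 0 < l → laplace p l * (l + b) = s) : False := by
  have hb : ∀ l, 0 < l → 0 < l + b := fun l hl =>
    pos_of_mul_pos_right ((h l hl).symm ▸ hs) (hp.laplace_pos hl).le
  have hb0 : 0 ≤ b := by
    by_contra! hcon
    have := hb (-b / 2) (by linarith)
    linarith
  have hid : Tendsto (fun l : ℝ => l) (𝓝[>] 0) (𝓝 0) := tendsto_id.mono_left nhdsWithin_le_nhds
  rcases hb0.eq_or_lt with hb0 | hb0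
  · have hp0 : Tendsto (fun t => p t * t ^ (0 : ℝ)) atTop (𝓝 0) := by
      have h1 := htail.mul (tendsto_rpow_neg_atTop hα)
      rw [mul_zero] at h1
      refine h1.congr' ?_
      filter_upwards [eventually_gt_atTop 0] with t ht
      rw [mul_assoc, ← Real.rpow_add ht, add_neg_cancel]
    have h1 := tendsto_scaled_integral hp.measurable hp.nonneg (C := 1)
      (fun t _ => by simpa using hp.le_one t) hp0 (K := fun s => Real.exp (-s)) (by fun_prop)
      (fun s _ => (Real.exp_pos _).le) (by simpa using integrableOn_exp_neg_mul one_pos)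
    rw [zero_mul] at h1
    have h2 : Tendsto (fun _ : ℝ => s) (𝓝[>] 0) (𝓝 0) := by
      refine h1.congr' ?_
      filter_upwards [self_mem_nhdsWithin] with l hl
      have := h l hl
      rw [← hb0, add_zero, laplace] at this
      rw [← this, sub_zero, Real.rpow_one, mul_comm]
    exact hs.ne' (tendsto_nhds_unique tendsto_const_nhds h2)
  · set n := ⌈α⌉₊ with hn
    obtain ⟨T, hT⟩ := eventually_atTop.1 (htail.eventually (lt_mem_nhds (half_lt_self hc)))
    set R := max T 1 with hR
    have hR1 : 1 ≤ R := le_max_right _ _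
    have hlow : ∀ t ∈ Set.Ioi R, c / 2 ≤ t ^ n * p t := by
      intro t ht
      have ht1 : 1 ≤ t := hR1.trans (le_of_lt ht)
      refine (hT t ((le_max_left T 1).trans (le_of_lt ht))).le.trans ?_
      rw [mul_comm (t ^ n)]
      refine mul_le_mul_of_nonneg_left ?_ (hp.nonneg t)
      rw [← Real.rpow_natCast]
      exact Real.rpow_le_rpow_of_exponent_le ht1 (Nat.le_ceil α)
    have hmom : ∀ l > 0, c / 2 * Real.exp (-(l * R)) ≤
        l * (n.factorial * s / b ^ (n + 1)) := by
      intro l hl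
      have hl : 0 < l := hl
      have e1 : ∫ t in Set.Ioi R, c / 2 * Real.exp (-(l * t)) ≤
          ∫ t in Set.Ioi (0 : ℝ), t ^ n * Real.exp (-(l * t)) * p t := by
        have hsub : Set.Ioi R ⊆ Set.Ioi 0 := Set.Ioi_subset_Ioi (by linarith)
        have hi := hp.integrableOn_pow_mul_laplace hl n
        refine le_trans ?_ (setIntegral_mono_set hi ?_ (Eventually.of_forall hsub))
        · refine setIntegral_mono_on (((integrableOn_exp_neg_mul hl).mono_set hsub).const_mul _)
            (hi.mono_set hsub) measurableSet_Ioi fun t ht => ?_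
          rw [mul_right_comm]
          exact mul_le_mul_of_nonneg_right (hlow t ht) (Real.exp_pos _).le
        · filter_upwards [ae_restrict_mem measurableSet_Ioi] with t ht
          exact mul_nonneg (mul_nonneg (pow_nonneg (le_of_lt ht) n) (Real.exp_pos _).le)
            (hp.nonneg t)
      have e2 : ∫ t in Set.Ioi R, Real.exp (-(l * t)) = Real.exp (-(l * R)) / l := by
        have := integral_exp_mul_Ioi (a := -l) (by linarith) R
        simpa [neg_mul, neg_div_neg_eq] using this
      rw [integral_const_mul, e2, hp.laplace_moment_eq hb h n l hl] at e1
      have e3 : n.factorial * s / (l + b) ^ (n + 1) ≤ n.factorial * s / b ^ (n + 1) := by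
        refine div_le_div_of_nonneg_left (by positivity) (by positivity) ?_
        exact pow_le_pow_left₀ hb0.le (by linarith) _
      have e4 := mul_le_mul_of_nonneg_left (e1.trans e3) hl.le
      refine le_trans (le_of_eq ?_) e4
      field_simp
    have l1 : Tendsto (fun l : ℝ => c / 2 * Real.exp (-(l * R))) (𝓝[>] 0) (𝓝 (c / 2)) := by
      have : Tendsto (fun l : ℝ => c / 2 * Real.exp (-(l * R))) (𝓝 0)
          (𝓝 (c / 2 * Real.exp (-(0 * R)))) :=
        (by fun_prop : Continuous fun l : ℝ => c / 2 * Real.exp (-(l * R))).tendsto 0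
      simp only [zero_mul, neg_zero, Real.exp_zero, mul_one] at this
      exact this.mono_left nhdsWithin_le_nhds
    have l2 := hid.mul_const (n.factorial * s / b ^ (n + 1))
    have := le_of_tendsto_of_tendsto l1 l2
      (by filter_upwards [self_mem_nhdsWithin] with l hl using hmom l hl)
    rw [zero_mul] at this
    linarith

/-- A convex rate function is strictly convex if the return probability decays polynomially. -/
lemma strictConvexOn_rate {α c : ℝ} (hα : 0 < α) (hc : 0 < c)
    (htail : Tendsto (fun t => p t * t ^ α) atTop (𝓝 c))
    (hconv : ConvexOn ℝ (Set.Ioi ((mass p)⁻¹).toReal) (rate p)) :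
    StrictConvexOn ℝ (Set.Ioi ((mass p)⁻¹).toReal) (rate p) := by
  refine LinearOrder.strictConvexOn_of_lt (convex_Ioi _) ?_
  intro x hx y hy hxy a b ha hb hab
  simp only [smul_eq_mul]
  by_contra! hcon
  set m := a * x + b * y with hm
  have hyx : 0 < y - x := sub_pos.2 hxy
  have hbx : m - x = b * (y - x) := by rw [hm, show a = 1 - b by linarith]; ring
  have hay : y - m = a * (y - x) := by rw [hm, show b = 1 - a by linarith]; ring
  have hxm : x < m := by rw [← sub_pos, hbx]; exact mul_pos hb hyx
  have hmy : m < y := by rw [← sub_pos, hay]; exact mul_pos ha hyx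
  have hmk : m ∈ Set.Ioi ((mass p)⁻¹).toReal := hx.trans hxm
  have hrm : rate p m = a * rate p x + b * rate p y :=
    le_antisymm (by simpa using hconv.2 hx hy ha.le hb.le hab) hcon
  have hmono := hp.rate_strictMonoOn
  set s := (rate p y - rate p x) / (y - x) with hs
  have hs0 : 0 < s := div_pos (sub_pos.2 (hmono hx hy hxy)) hyx
  have hsy : rate p y = rate p x + s * (y - x) := by rw [hs, div_mul_cancel₀ _ hyx.ne']; ring
  have hrm' : rate p m = rate p x + s * (m - x) := by
    rw [hrm, hsy, hbx, show a = 1 - b by linarith]; ring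
  -- Contact with the chord at m forces contact on (x, m): convexity on x, z, m gives the upper
  -- bound, and comparison of the slope on [z, m] with the slope s on [m, y] gives the lower bound.
  have haff : ∀ z ∈ Set.Ioo x m, rate p z = rate p x + s * (z - x) := by
    intro z hz
    have hzk : z ∈ Set.Ioi ((mass p)⁻¹).toReal := hx.trans hz.1
    have h1 := hconv.slope_mono_adjacent hx hmk hz.1 hz.2
    have h2 := hconv.slope_mono_adjacent hzk hy hz.2 hmy
    have d1 : 0 < z - x := sub_pos.2 hz.1
    have d2 : 0 < m - z := sub_pos.2 hz.2
    have d3 : 0 < y - m := sub_pos.2 hmy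
    have h3 : (rate p y - rate p m) / (y - m) = s := by
      rw [div_eq_iff d3.ne', hsy, hrm']; ring
    rw [h3, div_le_iff₀ d2] at h2
    rw [div_le_div_iff₀ d1 d2] at h1
    refine le_antisymm ?_ (by linarith)
    have h4 : rate p z * (m - x) ≤ (rate p x + s * (z - x)) * (m - x) := by
      rw [hrm'] at h1
      nlinarith
    exact le_of_mul_le_mul_right h4 (by linarith)
  have hx0 : 0 < x := ENNReal.toReal_nonneg.trans_lt hx
  have hrx : 0 < rate p x := (hp.rate_spec hx0 hx).1
  -- The inverse function of the rate is l ↦ 1/p̂(l), so an affine piece of the rate is a rational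
  -- piece of p̂.
  have hloc : ∀ l ∈ Set.Ioo (rate p x) (rate p m),
      laplace p l * (l + (s * x - rate p x)) = s := by
    intro l hl
    have hl0 : 0 < l := hrx.trans hl.1
    have hL := hp.laplace_pos hl0
    have hroot : (laplace p l)⁻¹ * laplace p l = 1 := inv_mul_cancel₀ hL.ne'
    have hzk : (laplace p l)⁻¹ ∈ Set.Ioi ((mass p)⁻¹).toReal :=
      (hp.exists_root_iff (inv_pos.2 hL)).1 ⟨l, hl0, hroot⟩
    have hrz := hp.rate_eq hl0 hroot
    have hz : (laplace p l)⁻¹ ∈ Set.Ioo x m :=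
      ⟨(hmono.lt_iff_lt hx hzk).1 (by rw [hrz]; exact hl.1),
        (hmono.lt_iff_lt hzk hmk).1 (by rw [hrz]; exact hl.2)⟩
    have h1 := haff _ hz
    rw [hrz] at h1
    have h2 : l + (s * x - rate p x) = s * (laplace p l)⁻¹ := by linarith
    rw [h2, mul_left_comm, mul_inv_cancel₀ hL.ne', mul_one]
  have hglob : Set.EqOn (fun l => laplace p l * (l + (s * x - rate p x))) (fun _ => s)
      (Set.Ioi 0) := by
    obtain ⟨l₀, hl₀⟩ := exists_between (hmono hx hmk hxm)
    refine AnalyticOnNhd.eqOn_of_preconnected_of_eventuallyEq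
      (fun l hl => (hp.laplace_analyticOnNhd l hl).mul (analyticAt_id.add analyticAt_const))
      (fun l _ => analyticAt_const) isPreconnected_Ioi (hrx.trans hl₀.1) ?_
    filter_upwards [Ioo_mem_nhds hl₀.1 hl₀.2] with l hl using hloc l hl
  exact hp.laplace_ne_rational hα hc htail hs0 fun l hl => hglob hl

end IsReturnProfile

namespace IsMarkovProcess

variable {S Ω : Type*} [MeasurableSpace S] [MeasurableSingletonClass S]
  [MeasurableSpace Ω] {a : S → S → ℝ} {P : S → Measure Ω} {X : ℝ≥0 → Ω → S}
  (hX : IsMarkovProcess a P X) (i : S)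

include hX

lemma expMoment_pos (κ : ℝ) (t : ℝ≥0) : 0 < expMoment P X i κ t := by
  have := hX.isProbabilityMeasure i
  exact integral_exp_pos (hX.integrable_exp_localTime i κ t)

/-- Hölder's inequality, obtained by normalising both exponentials to have mean 1 and using
convexity of exp pointwise. -/
lemma convexOn_log_expMoment (t : ℝ≥0) :
    ConvexOn ℝ Set.univ fun κ => Real.log (expMoment P X i κ t) := by
  refine ⟨convex_univ, fun x _ y _ u v hu hv huv => ?_⟩
  have := hX.isProbabilityMeasure i
  set A := Real.log (expMoment P X i x t) with hA
  set B := Real.log (expMoment P X i y t) with hB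
  have hnorm : ∀ κ : ℝ, ∫ ω, Real.exp (κ * localTime X i t ω -
      Real.log (expMoment P X i κ t)) ∂(P i) = 1 := by
    intro κ
    simp only [Real.exp_sub, Real.exp_log (hX.expMoment_pos i κ t)]
    rw [integral_div]
    exact div_self (hX.expMoment_pos i κ t).ne'
  have h_int : ∀ κ d : ℝ, Integrable (fun ω => Real.exp (κ * localTime X i t ω - d)) (P i) := by
    intro κ d
    simp only [Real.exp_sub]
    exact (hX.integrable_exp_localTime i κ t).div_const _
  have hle : ∫ ω, Real.exp ((u * x + v * y) * localTime X i t ω - (u * A + v * B)) ∂(P i) ≤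
      ∫ ω, (u * Real.exp (x * localTime X i t ω - A) +
        v * Real.exp (y * localTime X i t ω - B)) ∂(P i) := by
    refine integral_mono (h_int _ _) (((h_int x A).const_mul u).add ((h_int y B).const_mul v))
      fun ω => ?_
    have := convexOn_exp.2 (Set.mem_univ (x * localTime X i t ω - A))
      (Set.mem_univ (y * localTime X i t ω - B)) hu hv huv
    simp only [smul_eq_mul] at this
    refine le_trans (le_of_eq ?_) this
    congr 1
    ring
  rw [integral_add ((h_int x A).const_mul u) ((h_int y B).const_mul v), integral_const_mul,
    integral_const_mul, hnorm, hnorm, mul_one, mul_one, huv] at hle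
  simp only [Real.exp_sub] at hle
  rw [integral_div, div_le_one (Real.exp_pos _)] at hle
  simp only [smul_eq_mul]
  rw [Real.log_le_iff_le_exp (hX.expMoment_pos i _ t)]
  exact hle

/-- Convexity is hard to see from the root equation; it passes to the limit from the logarithmic
moments. -/
lemma convexOn_rate :
    ConvexOn ℝ (Set.Ioi 0) (rate fun t : ℝ => transProb P X t.toNNReal i i) := by
  refine ⟨convex_Ioi 0, fun x hx y hy u v hu hv huv => ?_⟩
  have hxy : 0 < u * x + v * y := convex_Ioi (0 : ℝ) hx hy hu hv huv
  refine le_of_tendsto_of_tendsto' (hX.tendsto_log_expMoment hxy i)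
    (((hX.tendsto_log_expMoment hx i).const_mul u).add
      ((hX.tendsto_log_expMoment hy i).const_mul v)) fun t => ?_
  have h := (hX.convexOn_log_expMoment i t).2 (Set.mem_univ x) (Set.mem_univ y) hu hv huv
  simp only [smul_eq_mul] at h
  refine (mul_le_mul_of_nonneg_left h (by positivity : 0 ≤ 1 / (t : ℝ))).trans (le_of_eq ?_)
  ring

end IsMarkovProcess

/-- Polynomial decay along nonnegative reals, restated as a limit along the reals. -/
lemma tendsto_mul_rpow_of_isEquivalent {f : ℝ≥0 → ℝ} {c α : ℝ} (hc : 0 < c)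
    (h : f ~[atTop] fun t : ℝ≥0 => c * (t : ℝ) ^ (-α)) :
    Tendsto (fun t : ℝ => f t.toNNReal * t ^ α) atTop (𝓝 c) := by
  have hne : ∀ᶠ t : ℝ≥0 in atTop, c * (t : ℝ) ^ (-α) ≠ 0 := by
    filter_upwards [eventually_gt_atTop 0] with t ht
    exact (mul_pos hc (Real.rpow_pos_of_pos (NNReal.coe_pos.2 ht) _)).ne'
  have h1 := (((isEquivalent_iff_tendsto_one hne).1 h).comp
    tendsto_real_toNNReal_atTop).mul_const c
  rw [one_mul] at h1
  refine h1.congr' ?_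
  filter_upwards [eventually_gt_atTop 0] with t ht
  have hpow := (Real.rpow_pos_of_pos ht α).ne'
  simp only [Function.comp, Pi.div_apply, Real.coe_toNNReal t ht.le, Real.rpow_neg ht.le]
  field_simp

end

end LocalTimeRate

/-! ### Assembly of the main theorem -/

open LocalTimeRate in
theorem mainTheorem7 {S Ω : Type*} [Countable S] [MeasurableSpace S] [MeasurableSingletonClass S]
    [MeasurableSpace Ω] (a : S → S → ℝ) (P : S → Measure Ω) (X : ℝ≥0 → Ω → S)
    (hX : IsMarkovProcess a P X) (i : S) :
    ∃ r : ℝ → ℝ,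
      (∀ κ : ℝ, 0 < κ →
        Tendsto (fun t : ℝ≥0 => (1 / (t : ℝ)) * Real.log (expMoment P X i κ t)) atTop
          (𝓝 (r κ))) ∧
      (∀ κ : ℝ, 0 < κ → 0 ≤ r κ ∧ (0 < r κ ↔ kappaCr P X i < κ)) ∧
      (∀ κ : ℝ, 0 < κ → r κ ≤ κ) ∧
      Tendsto (fun κ : ℝ => r κ / κ) atTop (𝓝 1) ∧
      ∀ c α : ℝ, 0 < c → 0 < α →
        (fun t : ℝ≥0 => transProb P X t i i) ~[atTop] (fun t : ℝ≥0 => c * (t : ℝ) ^ (-α)) →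
        StrictConvexOn ℝ (Set.Ioi (kappaCr P X i)) r ∧
        (α ≤ 1 → kappaCr P X i = 0) ∧
        (α < 1 →
          r ~[𝓝[>] 0] fun κ : ℝ =>
            κ ^ (1 / (1 - α)) * (c * Real.Gamma (1 - α)) ^ (1 / (1 - α))) ∧
        (α = 1 →
          ∃ ε : ℝ → ℝ, ε =o[𝓝[>] 0] (fun κ : ℝ => κ⁻¹) ∧
            r ~[𝓝[>] 0] fun κ : ℝ => Real.exp (-(c * κ)⁻¹ + ε κ)) ∧
        (1 < α → green P X i ≠ ⊤ ∧ 0 < kappaCr P X i) ∧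
        (1 < α → α < 2 →
          r ~[𝓝[>] (kappaCr P X i)] fun κ : ℝ =>
            (κ - kappaCr P X i) ^ (1 / (α - 1)) *
              ((green P X i).toReal ^ 2 * (α - 1) / (c * Real.Gamma (2 - α))) ^ (1 / (α - 1))) ∧
        (α = 2 →
          r ~[𝓝[>] (kappaCr P X i)] fun κ : ℝ =>
            (κ - kappaCr P X i) / Real.log (1 / (κ - kappaCr P X i)) *
              ((green P X i).toReal ^ 2 / c)) ∧
        (2 < α →
          greenMoment P X i ≠ ⊤ ∧
          r ~[𝓝[>] (kappaCr P X i)] fun κ : ℝ =>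
            (κ - kappaCr P X i) *
              ((green P X i).toReal ^ 2 / (greenMoment P X i).toReal)) := by
  have hp := hX.isReturnProfile i
  refine ⟨rate fun t : ℝ => transProb P X t.toNNReal i i,
    fun κ hκ => hX.tendsto_log_expMoment hκ i,
    fun κ hκ => ⟨hp.rate_nonneg hκ, hp.rate_pos_iff hκ⟩, fun κ hκ => hp.rate_le hκ,
    hp.tendsto_rate_div, fun c α hc hα hequiv => ?_⟩
  have htail := tendsto_mul_rpow_of_isEquivalent hc hequiv
  refine ⟨?_, fun h => ?_, fun h => hp.rate_isEquivalent_of_lt_one hc htail hα h,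
    fun h => hp.rate_isEquivalent_of_eq_one hc htail h, fun h => ?_,
    fun h1 h2 => hp.rate_isEquivalent_of_lt_two hc htail h1 h2,
    fun h => hp.rate_isEquivalent_of_eq_two hc htail h, fun h => ?_⟩
  · exact hp.strictConvexOn_rate hα hc htail ((hX.convexOn_rate i).subset
      (Set.Ioi_subset_Ioi ENNReal.toReal_nonneg) (convex_Ioi _))
  -- `green` is definitionally the `mass` of the return profile, so results on the profile apply
  -- verbatim.
  · have htop : green P X i = ⊤ := hp.mass_eq_top hα htail hc h
    simp [kappaCr, htop]
  · have hfin : green P X i ≠ ⊤ := hp.mass_ne_top htail h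
    refine ⟨hfin, ENNReal.toReal_pos (ENNReal.inv_ne_zero.2 hfin) (ENNReal.inv_ne_top.2 ?_)⟩
    exact hp.mass_pos.ne'
  · have h_int := hp.integrableOn_mul_self htail h
    have hnn : 0 ≤ᵐ[volume.restrict (Set.Ioi (0 : ℝ))]
        fun t : ℝ => t * transProb P X t.toNNReal i i := by
      filter_upwards [ae_restrict_mem measurableSet_Ioi] with t ht
      exact mul_nonneg (le_of_lt ht) (hp.nonneg t)
    refine ⟨((hasFiniteIntegral_iff_ofReal hnn).1 h_int.2).ne, ?_⟩
    have hH : (greenMoment P X i).toReal =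
        ∫ t in Set.Ioi (0 : ℝ), t * transProb P X t.toNNReal i i := by
      rw [integral_eq_lintegral_of_nonneg_ae hnn h_int.1]
      rfl
    rw [hH]
    exact hp.rate_isEquivalent_of_two_lt htail h
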